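/- **Setting.** Let $\mathcal X\subset\mathbb R^p$ and, for each $\mathbf x\in\mathcal X$, let $Y(\mathbf x)$ be a real random variable (sales volume) with CDF $F_Y(\cdot|\mathbf x)$, density $f_Y(\cdot|\mathbf x)$ and quantile function $F_Y^{-1}(\tau|\mathbf x)=\inf\{y: F_Y(y|\mathbf x)\ge\tau\}$. Let $\mathbf x_1,\mathbf x_2,\dots\in\mathcal X$ be deterministic design points and let $y_1,y_2,\dots$ be independent random variables on a probability space, $y_i$ having the law of $Y(\mathbf x_i)$. Assume: 1. (Linear quantile regression model) $F_Y^{-1}(\tau|\mathbf x)=\boldsymbol\beta(\tau)^\top\mathbf x$ for all $\tau\in(0,1)$ and $\mathbf x\in\mathcal X$, with $\boldsymbol\beta$ continuous on $(0,1)$. 2. $F_Y(\cdot|\mathbf x)$ is absolutely continuous with a support that is the same for all $\mathbf x\in\mathcal X$, and for every $0<\tau_\ell<\tau_u<1$ the values $f_Y(F_Y^{-1}(\tau|\mathbf x)|\mathbf x)$ are bounded away from $0$ and from $\infty$ uniformly over $\tau\in[\tau_\ell,\tau_u]$ and $\mathbf x\in\mathcal X$. 3. For every $0<\tau_\ell<\tau_u<1$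 there are positive definite matrices $D_0$ and $D_1(\tau)$, $\tau\in[\tau_\ell,\tau_u]$, such that $\frac1n\sum_{i=1}^n\mathbf x_i\mathbf x_i^\top\to D_0$ and $\frac1n\sum_{i=1}^n f_Y(F_Y^{-1}(\tau|\mathbf x_i)|\mathbf x_i)\,\mathbf x_i\mathbf x_i^\top\to D_1(\tau)$ uniformly over $\tau\in[\tau_\ell,\tau_u]$; moreover $\max_{1\le i\le n}\|\mathbf x_i\|=o(\sqrt n)$. For $\tau\in(0,1)$ let $\hat{\boldsymbol\beta}(\tau)$ be any measurable choice of a minimizer over $\mathbf b\in\mathbb R^p$ of $\sum_{i=1}^n\rho_\tau(y_i-\mathbf b^\top\mathbf x_i)$, where $\rho_\tau(u)=[\tau-I(u\le0)]u$, and put $\hat Q_\tau(\mathbf x)=\hat{\boldsymbol\beta}(\tau)^\top\mathbf x$ and $\tau_j=j/m$. With $U$ uniform on $(0,1)$ and independent of the data, the QRGMM output $\hat Y(\mathbf x)$ is $\hat Q_{\tau_1}(\mathbf x)$ if $U<\tau_1$, is $\hat Q_{\tau_{m-1}}(\mathbf x)$ if $U\ge\tau_{m-1}$, and is $\hat Q_{\tau_j}(\mathbf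 x)+m(U-\tau_j)[\hat Q_{\tau_{j+1}}(\mathbf x)-\hat Q_{\tau_j}(\mathbf x)]$ if $U\in[\tau_j,\tau_{j+1})$, $1\le j\le m-2$. Let $r>0$ be the net unit revenue and $\bar l\ge0$ the maximum loan. The default probability of a loan $l$ is $r_1(l)=\Pr\{(l-rY(\mathbf x))^+>0\}$, and its QRGMM-based estimate is $\hat r_1(l)=F_{\hat Y}(l/r|\mathbf x)$, where $F_{\hat Y}(\cdot|\mathbf x)$ is the CDF of $\hat Y(\mathbf x)$. **Theorem.** For every $\mathbf x\in\mathcal X$ one has $r_1(l)=F_Y(l/r|\mathbf x)$ for $l\in[0,\bar l]$, and, as $n,m\to\infty$ jointly (with no relation imposed between $n$ and $m$): (a) for every $l\in[0,\bar l]$, $\hat r_1(l)\to r_1(l)$; (b) $\sup_{l\in[0,\bar l]}|\hat r_1(l)-r_1(l)|\to0$. Both hold for each of the two meanings of $F_{\hat Y}$: when it is the (deterministic) CDF of $\hat Y(\mathbf x)$ under the joint randomness of the data and $U$, the convergence is that of real numbers; when it is the conditional CDF of $\hat Y(\mathbf x)$ given the data, so that $\hat r_1(l)$ is random, the convergence is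 in probability. -/

import Mathlib

open MeasureTheory ProbabilityTheory Filter Topology Set

noncomputable section

/-- The quantile function `F⁻¹(τ) = inf {y | τ ≤ F(y)}` of a law on the line, for `0 < τ < 1`. -/
def quantile (μ : Measure ℝ) (τ : ℝ) : ℝ := sInf {y : ℝ | τ ≤ cdf μ y}

/-- `f` is a Lebesgue density of `μ`. -/
def IsDensity (μ : Measure ℝ) (f : ℝ → ℝ) : Prop :=
  Measurable f ∧ (∀ y, 0 ≤ f y) ∧ μ = volume.withDensity (fun y => ENNReal.ofReal (f y))

/-- Linear quantile regression model: the conditional quantile function is linear in the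
covariates, with coefficients depending continuously on the level `τ ∈ (0, 1)`. -/
def LinearQuantileModel {p : ℕ} (X : Set (EuclideanSpace ℝ (Fin p)))
    (law : EuclideanSpace ℝ (Fin p) → Measure ℝ) (β : ℝ → EuclideanSpace ℝ (Fin p)) : Prop :=
  (∀ x ∈ X, ∀ τ ∈ Ioo (0 : ℝ) 1, quantile (law x) τ = inner ℝ (β τ) x) ∧
    ContinuousOn β (Ioo 0 1)

/-- Regularity of the conditional laws: they have densities `f x` and a common support, and the
densities at the quantiles are bounded away from zero and from infinity, uniformly over the
covariates and over the levels in any compact subinterval of `(0, 1)`. -/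
def DensityRegular {p : ℕ} (X : Set (EuclideanSpace ℝ (Fin p)))
    (law : EuclideanSpace ℝ (Fin p) → Measure ℝ) (f : EuclideanSpace ℝ (Fin p) → ℝ → ℝ) : Prop :=
  (∀ x ∈ X, IsDensity (law x) (f x)) ∧
    (∃ S : Set ℝ, ∀ x ∈ X, (law x).support = S) ∧
    ∀ τl τu : ℝ, 0 < τl → τl < τu → τu < 1 → ∃ c C : ℝ, 0 < c ∧
      ∀ τ ∈ Icc τl τu, ∀ x ∈ X, c ≤ f x (quantile (law x) τ) ∧ f x (quantile (law x) τ) ≤ C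

/-- The matrix `x xᵀ`. -/
def outer {p : ℕ} (x : EuclideanSpace ℝ (Fin p)) : Matrix (Fin p) (Fin p) ℝ :=
  Matrix.of fun i j => x i * x j

/-- Regularity of the design points `x₁, x₂, …` (indexed from `0` here). -/
def DesignRegular {p : ℕ} (law : EuclideanSpace ℝ (Fin p) → Measure ℝ)
    (f : EuclideanSpace ℝ (Fin p) → ℝ → ℝ) (xs : ℕ → EuclideanSpace ℝ (Fin p)) : Prop :=
  (∀ τl τu : ℝ, 0 < τl → τl < τu → τu < 1 →
    ∃ (D₀ : Matrix (Fin p) (Fin p) ℝ) (D₁ : ℝ → Matrix (Fin p) (Fin p) ℝ),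
      D₀.PosDef ∧ (∀ τ ∈ Icc τl τu, (D₁ τ).PosDef) ∧
      Tendsto (fun n : ℕ => (1 / (n : ℝ)) • ∑ i ∈ Finset.range n, outer (xs i)) atTop (𝓝 D₀) ∧
      TendstoUniformlyOn
        (fun (n : ℕ) (τ : ℝ) => (1 / (n : ℝ)) •
          ∑ i ∈ Finset.range n, f (xs i) (quantile (law (xs i)) τ) • outer (xs i))
        D₁ atTop (Icc τl τu)) ∧
  (fun n : ℕ => ⨆ i : Fin n, ‖xs i‖) =o[atTop] (fun n : ℕ => Real.sqrt n)

/-- The pinball loss `ρ_τ(u) = [τ - I(u ≤ 0)] u`. -/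
def pinball (τ u : ℝ) : ℝ := (τ - if u ≤ 0 then 1 else 0) * u

/-- The quantile regression objective `b ↦ ∑ᵢ ρ_τ(yᵢ - bᵀxᵢ)` over the first `n` data points. -/
def qrObjective {p : ℕ} (xs : ℕ → EuclideanSpace ℝ (Fin p)) (ys : ℕ → ℝ) (n : ℕ) (τ : ℝ)
    (b : EuclideanSpace ℝ (Fin p)) : ℝ :=
  ∑ i ∈ Finset.range n, pinball τ (ys i - inner ℝ b (xs i))

/-- `βhat n τ ω` is a (measurable) quantile regression estimate at level `τ` from the first `n`
data points `(xs i, Y i ω)`: a minimizer of the pinball objective. -/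
def IsQREstimator {p : ℕ} {Ω : Type*} [MeasurableSpace Ω] (xs : ℕ → EuclideanSpace ℝ (Fin p))
    (Y : ℕ → Ω → ℝ) (βhat : ℕ → ℝ → Ω → EuclideanSpace ℝ (Fin p)) : Prop :=
  ∀ n : ℕ, ∀ τ ∈ Ioo (0 : ℝ) 1, Measurable (βhat n τ) ∧
    ∀ ω, IsMinOn (qrObjective xs (fun i => Y i ω) n τ) univ (βhat n τ ω)

/-- The online stage of QRGMM with the `m`-grid `τ_j = j / m`, `1 ≤ j ≤ m - 1`: the fitted quantile
values `q τ_j` are interpolated linearly, and extended by constants beyond `τ_1` and `τ_{m-1}`.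
In the last case `j = ⌊m u⌋` is the index with `u ∈ [τ_j, τ_{j+1})`. -/
def qrgmm (m : ℕ) (q : ℝ → ℝ) (u : ℝ) : ℝ :=
  if u < 1 / (m : ℝ) then q (1 / (m : ℝ))
  else if ((m : ℝ) - 1) / m ≤ u then q (((m : ℝ) - 1) / m)
  else
    let j : ℝ := (⌊(m : ℝ) * u⌋₊ : ℝ)
    q (j / m) + m * (u - j / m) * (q ((j + 1) / m) - q (j / m))

/-- The uniform law on `(0, 1)`. -/
def unif : Measure ℝ := volume.restrict (Ioo 0 1)

/-- The generated observation `Ŷ(x)` from `n` data points, a grid of size `m`, the data outcome `ω`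
and the uniform input `u`. -/
def genY {p : ℕ} {Ω : Type*} (βhat : ℕ → ℝ → Ω → EuclideanSpace ℝ (Fin p)) (n m : ℕ)
    (x : EuclideanSpace ℝ (Fin p)) (ω : Ω) (u : ℝ) : ℝ :=
  qrgmm m (fun τ => inner ℝ (βhat n τ ω) x) u

/-- `F_Ŷ(y | x)` of the fitted generator, given the data: only the uniform input is random. -/
def genCDFGiven {p : ℕ} {Ω : Type*} (βhat : ℕ → ℝ → Ω → EuclideanSpace ℝ (Fin p)) (n m : ℕ)
    (x : EuclideanSpace ℝ (Fin p)) (ω : Ω) (y : ℝ) : ℝ :=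
  unif.real {u | genY βhat n m x ω u ≤ y}

/-- `F_Ŷ(y | x)` of the random variable `Ŷ(x)`: the data and the independent uniform input are
both random. -/
def genCDF {p : ℕ} {Ω : Type*} [MeasurableSpace Ω] (P : Measure Ω)
    (βhat : ℕ → ℝ → Ω → EuclideanSpace ℝ (Fin p)) (n m : ℕ)
    (x : EuclideanSpace ℝ (Fin p)) (y : ℝ) : ℝ :=
  (P.prod unif).real {z | genY βhat n m x z.1 z.2 ≤ y}

/-- The default probability `r₁(l) = Pr{L(l) > 0}` for the loss `L(l) = (l - r Y)⁺`, where the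
sales volume `Y` has law `μ`. -/
def defaultProb (μ : Measure ℝ) (r l : ℝ) : ℝ := μ.real {y | 0 < max (l - r * y) 0}

end

/-! The argument rests on the inverse transform. With `q` the true quantile function, `q(U)` has the
law of `Y(x)`, so it is enough that `Ŷ(x)` be within `ε` of `q(U)` off an event of small
probability. Such a perturbation moves a CDF by at most that probability plus an increment of the
true CDF over length `2ε` (`abs_measureReal_le_sub_le`), and the increment is small uniformly over a
compact range of loans (`exists_forall_cdf_sub_le`).

For fixed `u`, interpolation mixes the fits at two levels within `1/m` of `u`. If the fits are
consistent at a rate uniform over compact level intervals, continuity of `β` gives convergence for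
every `u` with no relation between `n` and `m`; dominated convergence in `u` gives the joint
statement (`tendsto_prod_genErrorSet`). The conditional statement follows by Markov's inequality
applied to the conditional probability of the error event.

Uniform consistency (`eventually_measureReal_norm_sub_le`) uses convexity: a minimizer far from
`β(τ)` forces the objective somewhere on the sphere of radius `M/√n` about `β(τ)` to be no larger
than at the centre. On that sphere the increment is a quadratic gain of order `M²` minus a score
term of order `M`, so for large `M` this is unlikely. A finite net of directions replaces the
sphere. -/

/-! ### Distribution and quantile functions of atomless laws. -/

theorem continuous_cdf (μ : Measure ℝ) [IsProbabilityMeasure μ] [NullSingletonClass μ] :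
    Continuous (cdf μ) := by
  refine continuous_iff_continuousAt.2 fun a => ?_
  rw [(monotone_cdf μ).continuousAt_iff_leftLim_eq_rightLim, StieltjesFunction.rightLim_eq]
  have h : (cdf μ).measure {a} = 0 := by rw [measure_cdf]; exact measure_singleton a
  rw [StieltjesFunction.measure_singleton, ENNReal.ofReal_eq_zero] at h
  exact le_antisymm ((monotone_cdf μ).leftLim_le le_rfl) (by linarith)

theorem IsDensity.nullSingletonClass {μ : Measure ℝ} {f : ℝ → ℝ} (h : IsDensity μ f) : NullSingletonClass μ := by
  rw [h.2.2]
  refine ⟨fun a => withDensity_absolutelyContinuous _ _ (measure_singleton a)⟩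

theorem measureReal_Ioc_eq_cdf_sub (μ : Measure ℝ) [IsProbabilityMeasure μ] {a b : ℝ}
    (hab : a ≤ b) : μ.real (Ioc a b) = cdf μ b - cdf μ a := by
  rw [cdf_eq_real, cdf_eq_real, show Ioc a b = Iic b \ Iic a by ext y; simp [and_comm],
    measureReal_sdiff (Iic_subset_Iic.2 hab) measurableSet_Iic]

theorem bddBelow_setOf_le_cdf (μ : Measure ℝ) {τ : ℝ} (h0 : 0 < τ) :
    BddBelow {y : ℝ | τ ≤ cdf μ y} := by
  obtain ⟨y, hy⟩ := ((tendsto_cdf_atBot μ).eventually_lt_const h0).exists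
  refine ⟨y, fun z hz => ?_⟩
  by_contra! hlt
  exact absurd (hz.trans (monotone_cdf μ hlt.le)) (not_le.2 hy)

/-- Continuity makes the superlevel set closed, so the infimum is attained; to its left the CDF is
below `τ`, and the left limit gives the reverse inequality. -/
theorem cdf_quantile (μ : Measure ℝ) [IsProbabilityMeasure μ] [NullSingletonClass μ] {τ : ℝ}
    (hτ : τ ∈ Ioo (0 : ℝ) 1) : cdf μ (quantile μ τ) = τ := by
  have hc := continuous_cdf μ
  have hb := bddBelow_setOf_le_cdf μ hτ.1
  obtain ⟨y, hy⟩ := ((tendsto_cdf_atTop μ).eventually_const_lt hτ.2).exists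
  refine le_antisymm ?_ ((isClosed_Ici.preimage hc).csInf_mem ⟨y, hy.le⟩ hb)
  refine le_of_tendsto (hc.tendsto (quantile μ τ) |>.mono_left nhdsWithin_le_nhds :
    Tendsto (cdf μ) (𝓝[<] (quantile μ τ)) _) ?_
  filter_upwards [self_mem_nhdsWithin] with z hz
  by_contra! hlt
  exact absurd (csInf_le hb hlt.le) (not_le.2 hz)

theorem quantile_le_iff (μ : Measure ℝ) [IsProbabilityMeasure μ] [NullSingletonClass μ] {τ y : ℝ}
    (hτ : τ ∈ Ioo (0 : ℝ) 1) : quantile μ τ ≤ y ↔ τ ≤ cdf μ y := by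
  constructor
  · intro h
    exact (cdf_quantile μ hτ).symm.le.trans (monotone_cdf μ h)
  · exact fun h => csInf_le (bddBelow_setOf_le_cdf μ hτ.1) h

theorem quantile_mono (μ : Measure ℝ) [IsProbabilityMeasure μ] [NullSingletonClass μ] {s t : ℝ}
    (hs : s ∈ Ioo (0 : ℝ) 1) (ht : t ∈ Ioo (0 : ℝ) 1) (hst : s ≤ t) :
    quantile μ s ≤ quantile μ t :=
  (quantile_le_iff μ hs).2 (hst.trans (cdf_quantile μ ht).symm.le)

/-! ### Mass of short intervals around quantiles. -/

theorem IsDensity.mul_le_measureReal_Ioc {μ : Measure ℝ} [IsProbabilityMeasure μ] {f : ℝ → ℝ}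
    (h : IsDensity μ f) {a b c : ℝ} (hab : a ≤ b) (hf : ∀ y ∈ Ioc a b, c ≤ f y) :
    c * (b - a) ≤ μ.real (Ioc a b) := by
  rcases le_or_gt c 0 with hc | hc
  · exact (mul_nonpos_of_nonpos_of_nonneg hc (sub_nonneg.2 hab)).trans measureReal_nonneg
  have hle : ENNReal.ofReal (c * (b - a)) ≤ μ (Ioc a b) := by
    rw [h.2.2, withDensity_apply _ measurableSet_Ioc, ENNReal.ofReal_mul hc.le, ← Real.volume_Ioc,
      ← setLIntegral_const]
    exact setLIntegral_mono' measurableSet_Ioc fun y hy => ENNReal.ofReal_le_ofReal (hf y hy)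
  exact (ENNReal.ofReal_le_iff_le_toReal (measure_ne_top _ _)).1 hle

theorem IsDensity.measureReal_Ioc_le_mul {μ : Measure ℝ} [IsProbabilityMeasure μ] {f : ℝ → ℝ}
    (h : IsDensity μ f) {a b C : ℝ} (hab : a ≤ b) (hC : 0 ≤ C) (hf : ∀ y ∈ Ioc a b, f y ≤ C) :
    μ.real (Ioc a b) ≤ C * (b - a) := by
  refine ENNReal.toReal_le_of_le_ofReal (mul_nonneg hC (sub_nonneg.2 hab)) ?_
  rw [h.2.2, withDensity_apply _ measurableSet_Ioc, ENNReal.ofReal_mul hC, ← Real.volume_Ioc,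
    ← setLIntegral_const]
  exact setLIntegral_mono' measurableSet_Ioc fun y hy => ENNReal.ofReal_le_ofReal (hf y hy)

/-- Around each quantile, a law with regular density charges short intervals proportionally to
their length, uniformly over the levels in `[τl, τu]` and over the covariates. -/
theorem exists_mass_bounds_near_quantile {p : ℕ} {X : Set (EuclideanSpace ℝ (Fin p))}
    {law : EuclideanSpace ℝ (Fin p) → Measure ℝ} [∀ x, IsProbabilityMeasure (law x)]
    {f : EuclideanSpace ℝ (Fin p) → ℝ → ℝ} {β : ℝ → EuclideanSpace ℝ (Fin p)}
    (h1 : LinearQuantileModel X law β) (h2 : DensityRegular X law f) {τl τu : ℝ}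
    (hl : 0 < τl) (hlu : τl < τu) (hu : τu < 1) :
    ∃ c C w₀ : ℝ, 0 < c ∧ 0 < C ∧ 0 < w₀ ∧ ∀ x ∈ X, ∀ τ ∈ Icc τl τu, ∀ w : ℝ, 0 ≤ w → w ≤ w₀ →
      c * w ≤ (law x).real (Ioc (quantile (law x) τ) (quantile (law x) τ + w)) ∧
      c * w ≤ (law x).real (Ioc (quantile (law x) τ - w) (quantile (law x) τ)) ∧
      (law x).real (Icc (quantile (law x) τ - w) (quantile (law x) τ + w)) ≤ 2 * C * w := by
  -- A wider window of levels leaves room on both sides of `[τl, τu]` for the intervals of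
  -- half-width `w`.
  set τa := τl / 2 with hτa
  set τb := (1 + τu) / 2 with hτb
  have ha0 : 0 < τa := by linarith
  have hb1 : τb < 1 := by linarith
  obtain ⟨c, C₀, hc, hbd⟩ := h2.2.2 τa τb ha0 (by linarith) hb1
  set C := max C₀ 1 with hC
  have hCpos : 0 < C := lt_of_lt_of_le one_pos (le_max_right _ _)
  set g := min (τl - τa) (τb - τu) with hg
  have hgpos : 0 < g := lt_min (by linarith) (by linarith)
  refine ⟨c, C, g / C, hc, hCpos, div_pos hgpos hCpos, fun x hx τ hτ w hw0 hw => ?_⟩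
  set μ := law x with hμ
  have hd := h2.1 x hx
  have : NullSingletonClass μ := hd.nullSingletonClass
  have mem : ∀ {t}, t ∈ Icc τa τb → t ∈ Ioo (0 : ℝ) 1 := fun ht =>
    ⟨lt_of_lt_of_le ha0 ht.1, lt_of_le_of_lt ht.2 hb1⟩
  have hmem : τ ∈ Icc τa τb := ⟨by linarith [hτ.1], by linarith [hτ.2]⟩
  have hma : τa ∈ Icc τa τb := ⟨le_rfl, by linarith⟩
  have hmb : τb ∈ Icc τa τb := ⟨by linarith, le_rfl⟩
  have hcont : ContinuousOn (quantile μ) (Icc τa τb) := by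
    have : ContinuousOn (fun t => inner ℝ (β t) x) (Icc τa τb) :=
      (h1.2.mono fun t ht => mem ht).inner continuousOn_const
    exact this.congr fun t ht => h1.1 x hx t (mem ht)
  -- The density is controlled only at quantiles; since the quantile function is continuous, every
  -- point between two quantiles is one.
  have hf : ∀ y ∈ Icc (quantile μ τa) (quantile μ τb), c ≤ f x y ∧ f x y ≤ C := by
    intro y hy
    obtain ⟨t, ht, rfl⟩ := intermediate_value_Icc (by linarith : τa ≤ τb) hcont hy
    exact ⟨(hbd t ht x hx).1, (hbd t ht x hx).2.trans (le_max_left _ _)⟩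
  have hqa := quantile_mono μ (mem hma) (mem hmem) hmem.1
  have hqb := quantile_mono μ (mem hmem) (mem hmb) hmem.2
  have hCw : C * w ≤ g := by rw [mul_comm]; exact (le_div_iff₀ hCpos).1 hw
  set q := quantile μ τ with hq
  -- Climbing from level `τ` to `τb` takes mass at least `g`, hence length at least `g / C` because
  -- the density is at most `C`.
  have hright : q + w ≤ quantile μ τb := by
    have h := hd.measureReal_Ioc_le_mul hqb hCpos.le
      (fun y hy => (hf y ⟨hqa.trans hy.1.le, hy.2⟩).2)
    rw [measureReal_Ioc_eq_cdf_sub _ hqb, cdf_quantile μ (mem hmb), cdf_quantile μ (mem hmem)] at h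
    have : g ≤ τb - τ := (min_le_right _ _).trans (by linarith [hτ.2])
    have : C * w ≤ C * (quantile μ τb - q) := by linarith
    linarith [le_of_mul_le_mul_left this hCpos]
  have hleft : quantile μ τa ≤ q - w := by
    have h := hd.measureReal_Ioc_le_mul hqa hCpos.le
      (fun y hy => (hf y ⟨hy.1.le, hy.2.trans hqb⟩).2)
    rw [measureReal_Ioc_eq_cdf_sub _ hqa, cdf_quantile μ (mem hma), cdf_quantile μ (mem hmem)] at h
    have : g ≤ τ - τa := (min_le_left _ _).trans (by linarith [hτ.1])
    have : C * w ≤ C * (q - quantile μ τa) := by linarith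
    linarith [le_of_mul_le_mul_left this hCpos]
  refine ⟨?_, ?_, ?_⟩
  · have := hd.mul_le_measureReal_Ioc (c := c) (a := q) (b := q + w) (by linarith)
      (fun y hy => (hf y ⟨hqa.trans hy.1.le, hy.2.trans hright⟩).1)
    simpa using this
  · have := hd.mul_le_measureReal_Ioc (c := c) (a := q - w) (b := q) (by linarith)
      (fun y hy => (hf y ⟨hleft.trans hy.1.le, hy.2.trans hqb⟩).1)
    simpa using this
  · have h := hd.measureReal_Ioc_le_mul (a := q - w) (b := q + w) (by linarith) hCpos.le
      (fun y hy => (hf y ⟨hleft.trans hy.1.le, hy.2.trans hright⟩).2)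
    rw [← measureReal_congr (Ioc_ae_eq_Icc (μ := μ))]
    linarith

/-! ### Consequences of the design conditions. -/

theorem sum_inner_sq_eq {p : ℕ} (xs : ℕ → EuclideanSpace ℝ (Fin p)) (n : ℕ)
    (e : EuclideanSpace ℝ (Fin p)) :
    ∑ k, ∑ l, e k * e l * ((1 / (n : ℝ)) • ∑ i ∈ Finset.range n, outer (xs i)) k l =
      (1 / (n : ℝ)) * ∑ i ∈ Finset.range n, (inner ℝ e (xs i)) ^ 2 := by
  have h : ∀ i, (inner ℝ e (xs i)) ^ 2 = ∑ k, ∑ l, e k * e l * (xs i k * xs i l) := by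
    intro i
    simp only [PiLp.inner_apply, RCLike.inner_apply, conj_trivial, sq, Finset.sum_mul_sum]
    exact Finset.sum_congr rfl fun k _ => Finset.sum_congr rfl fun l _ => by ring
  simp only [h, Matrix.smul_apply, Matrix.sum_apply, outer, Matrix.of_apply, smul_eq_mul,
    Finset.mul_sum]
  rw [Finset.sum_comm' (t' := Finset.univ) (s' := fun _ => Finset.range n)]
  · refine Finset.sum_congr rfl fun k _ => ?_
    rw [Finset.sum_comm]
    exact Finset.sum_congr rfl fun i _ => Finset.sum_congr rfl fun l _ => by ring
  · simp [and_comm]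

/-- Take traces in the convergence to `D₀`. The window `[1/4, 3/4]` is an arbitrary choice. -/
theorem DesignRegular.exists_sum_norm_sq_le {p : ℕ} {law : EuclideanSpace ℝ (Fin p) → Measure ℝ}
    {f : EuclideanSpace ℝ (Fin p) → ℝ → ℝ} {xs : ℕ → EuclideanSpace ℝ (Fin p)}
    (h : DesignRegular law f xs) :
    ∃ K : ℝ, 0 < K ∧ ∀ᶠ n : ℕ in atTop, ∑ i ∈ Finset.range n, ‖xs i‖ ^ 2 ≤ K * n := by
  obtain ⟨D₀, -, -, -, hD, -⟩ := h.1 (1 / 4) (3 / 4) (by norm_num) (by norm_num) (by norm_num)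
  have ht := (Continuous.matrix_trace continuous_id).tendsto D₀ |>.comp hD
  refine ⟨max (D₀.trace + 1) 1, by positivity, ?_⟩
  filter_upwards [ht.eventually_le_const (lt_add_one _), eventually_gt_atTop 0] with n hn hpos
  have hpos' : (0 : ℝ) < n := by exact_mod_cast hpos
  have : Matrix.trace ((1 / (n : ℝ)) • ∑ i ∈ Finset.range n, outer (xs i)) =
      (1 / (n : ℝ)) * ∑ i ∈ Finset.range n, ‖xs i‖ ^ 2 := by
    rw [Matrix.trace_smul, Matrix.trace_sum, smul_eq_mul]
    congr 1
    refine Finset.sum_congr rfl fun i _ => ?_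
    rw [EuclideanSpace.norm_sq_eq]
    simp [Matrix.trace, outer, sq]
  simp only [Function.comp_apply, id] at hn
  rw [this, one_div, inv_mul_le_iff₀ hpos'] at hn
  rw [mul_comm]
  exact hn.trans (mul_le_mul_of_nonneg_left (le_max_left _ _) hpos'.le)

/-- The quadratic form of `D₀` has a positive minimum on the compact unit sphere. The threshold for
`n` may depend on `e`, which suffices for a finite net of directions. -/
theorem DesignRegular.exists_le_sum_inner_sq {p : ℕ} {law : EuclideanSpace ℝ (Fin p) → Measure ℝ}
    {f : EuclideanSpace ℝ (Fin p) → ℝ → ℝ} {xs : ℕ → EuclideanSpace ℝ (Fin p)}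
    (h : DesignRegular law f xs) :
    ∃ κ : ℝ, 0 < κ ∧ ∀ e : EuclideanSpace ℝ (Fin p), ‖e‖ = 1 →
      ∀ᶠ n : ℕ in atTop, κ * n ≤ ∑ i ∈ Finset.range n, (inner ℝ e (xs i)) ^ 2 := by
  obtain ⟨D₀, -, hpd, -, hD, -⟩ := h.1 (1 / 4) (3 / 4) (by norm_num) (by norm_num) (by norm_num)
  set Q : EuclideanSpace ℝ (Fin p) → ℝ := fun e => ∑ k, ∑ l, e k * e l * D₀ k l with hQ
  have hQc : Continuous Q := by fun_prop
  have hQpos : ∀ e ∈ Metric.sphere (0 : EuclideanSpace ℝ (Fin p)) 1, 0 < Q e := by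
    intro e he
    have hne : (e : Fin p → ℝ) ≠ 0 := by
      intro h0
      have : e = 0 := by ext i; exact congrFun h0 i
      simp [this] at he
    have := hpd.dotProduct_mulVec_pos hne
    simp only [dotProduct, Matrix.mulVec, Finset.mul_sum, Pi.star_apply, star_trivial] at this
    refine this.trans_eq (Finset.sum_congr rfl fun k _ => Finset.sum_congr rfl fun l _ => by ring)
  obtain ⟨κ, hκ, hκQ⟩ : ∃ κ : ℝ, 0 < κ ∧
      ∀ e ∈ Metric.sphere (0 : EuclideanSpace ℝ (Fin p)) 1, κ ≤ Q e := by
    -- The sphere is empty when `p = 0`.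
    rcases (Metric.sphere (0 : EuclideanSpace ℝ (Fin p)) 1).eq_empty_or_nonempty with h0 | hne
    · exact ⟨1, one_pos, by simp [h0]⟩
    · obtain ⟨e, he, hmin⟩ := (isCompact_sphere _ _).exists_isMinOn hne hQc.continuousOn
      exact ⟨Q e, hQpos e he, fun e' he' => hmin he'⟩
  refine ⟨κ / 2, by positivity, fun e he => ?_⟩
  have hlim : Tendsto (fun n : ℕ =>
      (1 / (n : ℝ)) * ∑ i ∈ Finset.range n, (inner ℝ e (xs i)) ^ 2) atTop (𝓝 (Q e)) := by
    simp only [← sum_inner_sq_eq]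
    refine tendsto_finsetSum _ fun k _ => tendsto_finsetSum _ fun l _ => Tendsto.const_mul _ ?_
    exact ((continuous_id.matrix_elem k l).tendsto D₀).comp hD
  have hlt : κ / 2 < Q e := by linarith [hκQ e (by simpa using he)]
  filter_upwards [hlim.eventually_const_le hlt, eventually_gt_atTop 0] with n hn hpos
  have hpos' : (0 : ℝ) < n := by exact_mod_cast hpos
  rw [one_div, le_inv_mul_iff₀ hpos'] at hn
  linarith

theorem DesignRegular.eventually_norm_le {p : ℕ} {law : EuclideanSpace ℝ (Fin p) → Measure ℝ}
    {f : EuclideanSpace ℝ (Fin p) → ℝ → ℝ} {xs : ℕ → EuclideanSpace ℝ (Fin p)}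
    (h : DesignRegular law f xs) {η : ℝ} (hη : 0 < η) :
    ∀ᶠ n : ℕ in atTop, ∀ i < n, ‖xs i‖ ≤ η * √n := by
  filter_upwards [h.2.def hη] with n hn i hi
  have h1 : ‖xs i‖ ≤ ⨆ i : Fin n, ‖xs i‖ :=
    le_ciSup (f := fun i : Fin n => ‖xs i‖) (Set.finite_range _).bddAbove ⟨i, hi⟩
  rw [Real.norm_of_nonneg (Real.sqrt_nonneg _)] at hn
  exact h1.trans ((le_abs_self _).trans hn)

/-! ### Convexity of the objective and localization of its minimizers. -/

/-- A lower bound for the increment of the pinball loss, after removal of its linear part, when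
the residual `u` is shifted by `v`. -/
noncomputable def shiftGain (u v : ℝ) : ℝ :=
  |v| / 2 * ((if 0 < v then Ioc 0 (v / 2) else Ioc (v / 2) 0).indicator 1 u)

/-- By Knight's identity the increment plus `v (τ - I(u ≤ 0))` equals `R(v) = ∫₀ᵛ (I(u ≤ s) - I(u ≤
0)) ds`. This is at least `|v| / 2` when `u` lies in the half of the interval nearer to zero; it is
1-Lipschitz in `v` and vanishes for `|u| > V`, which bounds the cost of replacing `v` by `v'`. -/
theorem pinball_shift_ge {τ u v v' V : ℝ} (hv : |v| ≤ V) (hv' : |v'| ≤ V) :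
    shiftGain u v' - |v - v'| * (Icc (-V) V).indicator 1 u - v * (τ - if u ≤ 0 then 1 else 0) ≤
      pinball τ (u - v) - pinball τ u := by
  have hV := (abs_nonneg v).trans hv
  have h3 := abs_nonneg (v - v')
  have h1 := le_abs_self (v - v')
  have h2 := neg_abs_le (v - v')
  rw [abs_le] at hv hv'
  unfold shiftGain pinball
  simp only [Set.indicator_apply, Pi.one_apply, mem_Icc]
  generalize |v - v'| = d at *
  by_cases hV' : -V ≤ u ∧ u ≤ V <;> rcases le_or_gt u 0 with hu | hu <;>
    rcases le_or_gt (u - v) 0 with huv | huv <;>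
    rcases lt_or_ge 0 v' with hp | hp <;>
    simp only [hV', hu, huv, hp, hp.not_gt, if_true, if_false, not_le.2, Set.indicator_apply, Pi.one_apply, mem_Ioc, abs_of_pos,
      abs_of_nonpos, and_true, true_and, and_false] <;>
    (try split_ifs) <;> first | nlinarith | (exfalso; apply hV'; constructor <;> linarith)

theorem pinball_eq_max (τ u : ℝ) : pinball τ u = max (τ * u) ((τ - 1) * u) := by
  unfold pinball
  split_ifs with h
  · exact (max_eq_right (by linarith)).symm
  · rw [sub_zero]
    exact (max_eq_left (by linarith)).symm

theorem pinball_convex_comb_le (τ a b : ℝ) {s t : ℝ} (hs : 0 ≤ s) (ht : 0 ≤ t) :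
    pinball τ (s * a + t * b) ≤ s * pinball τ a + t * pinball τ b := by
  have ha1 : τ * a ≤ pinball τ a := pinball_eq_max τ a ▸ le_max_left _ _
  have ha2 : (τ - 1) * a ≤ pinball τ a := pinball_eq_max τ a ▸ le_max_right _ _
  have hb1 : τ * b ≤ pinball τ b := pinball_eq_max τ b ▸ le_max_left _ _
  have hb2 : (τ - 1) * b ≤ pinball τ b := pinball_eq_max τ b ▸ le_max_right _ _
  rw [pinball_eq_max τ (s * a + t * b)]
  refine max_le ?_ ?_
  · linarith [mul_le_mul_of_nonneg_left ha1 hs, mul_le_mul_of_nonneg_left hb1 ht]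
  · linarith [mul_le_mul_of_nonneg_left ha2 hs, mul_le_mul_of_nonneg_left hb2 ht]

theorem qrObjective_convex_comb_le {p : ℕ} (xs : ℕ → EuclideanSpace ℝ (Fin p)) (ys : ℕ → ℝ)
    (n : ℕ) (τ : ℝ) (b b' : EuclideanSpace ℝ (Fin p)) {s t : ℝ} (hs : 0 ≤ s) (ht : 0 ≤ t)
    (hst : s + t = 1) :
    qrObjective xs ys n τ (s • b + t • b') ≤
      s * qrObjective xs ys n τ b + t * qrObjective xs ys n τ b' := by
  unfold qrObjective
  rw [Finset.mul_sum, Finset.mul_sum, ← Finset.sum_add_distrib]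
  refine Finset.sum_le_sum fun i _ => ?_
  have : ys i - inner ℝ (s • b + t • b') (xs i) =
      s * (ys i - inner ℝ b (xs i)) + t * (ys i - inner ℝ b' (xs i)) := by
    rw [inner_add_left, real_inner_smul_left, real_inner_smul_left]
    linear_combination -(ys i) * hst
  rw [this]
  exact pinball_convex_comb_le _ _ _ hs ht

/-- If, along finitely many directions that are `η`-dense in the unit sphere, the quadratic part
of the objective at distance `ρ` from `β₀` dominates the linear part and the discretization error,
then all minimizers are within distance `ρ` of `β₀`. -/
theorem norm_sub_lt_of_isMinOn_qrObjective {p : ℕ} {xs : ℕ → EuclideanSpace ℝ (Fin p)}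
    {ys : ℕ → ℝ} {n : ℕ} {τ : ℝ} {β₀ b : EuclideanSpace ℝ (Fin p)} {u : ℕ → ℝ}
    (hu : ∀ i, u i = ys i - inner ℝ β₀ (xs i)) {ρ η A B D : ℝ} (hρ : 0 < ρ)
    {N : Finset (EuclideanSpace ℝ (Fin p))} (hN : ∀ k ∈ N, ‖k‖ = 1)
    (hcov : ∀ e : EuclideanSpace ℝ (Fin p), ‖e‖ = 1 → ∃ k ∈ N, ‖e - k‖ ≤ η)
    (hA : ∀ k ∈ N, A ≤ ∑ i ∈ Finset.range n, shiftGain (u i) (ρ * inner ℝ k (xs i)))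
    (hB : ∑ i ∈ Finset.range n,
      ρ * η * ‖xs i‖ * (Icc (-(ρ * ‖xs i‖)) (ρ * ‖xs i‖)).indicator 1 (u i) ≤ B)
    (hD : ρ * ‖∑ i ∈ Finset.range n, (τ - if u i ≤ 0 then 1 else 0) • xs i‖ ≤ D)
    (hABD : B + D < A) (hmin : IsMinOn (qrObjective xs ys n τ) univ b) : ‖b - β₀‖ < ρ := by
  by_contra! hge
  set s := ‖b - β₀‖ with hs
  have hspos : 0 < s := hρ.trans_le hge
  set e : EuclideanSpace ℝ (Fin p) := s⁻¹ • (b - β₀) with he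
  have hnorm : ‖e‖ = 1 := by
    rw [he, norm_smul, norm_inv, Real.norm_of_nonneg hspos.le, ← hs, inv_mul_cancel₀ hspos.ne']
  obtain ⟨k, hk, hek⟩ := hcov e hnorm
  -- The point where the segment from `β₀` to `b` crosses the sphere of radius `ρ`; by convexity the
  -- objective there is at most its value at `β₀`.
  have hcomb : β₀ + ρ • e = (1 - ρ / s) • β₀ + (ρ / s) • b := by
    rw [he, smul_smul, ← div_eq_mul_inv, smul_sub, sub_smul, one_smul]
    abel
  have hle1 : ρ / s ≤ 1 := (div_le_one hspos).2 hge
  have hupper : qrObjective xs ys n τ (β₀ + ρ • e) ≤ qrObjective xs ys n τ β₀ := by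
    rw [hcomb]
    refine (qrObjective_convex_comb_le xs ys n τ β₀ b (sub_nonneg.2 hle1) (by positivity)
      (by ring)).trans ?_
    have : qrObjective xs ys n τ b ≤ qrObjective xs ys n τ β₀ := hmin (mem_univ β₀)
    have := mul_le_mul_of_nonneg_left this (by positivity : 0 ≤ ρ / s)
    linarith
  have habs : ∀ {e' : EuclideanSpace ℝ (Fin p)} (i : ℕ), ‖e'‖ = 1 →
      |ρ * inner ℝ e' (xs i)| ≤ ρ * ‖xs i‖ := by
    intro e' i h
    rw [abs_mul, abs_of_pos hρ]
    have := abs_real_inner_le_norm e' (xs i)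
    rw [h, one_mul] at this
    gcongr
  have hterm : ∀ i ∈ Finset.range n, shiftGain (u i) (ρ * inner ℝ k (xs i)) -
      ρ * η * ‖xs i‖ * (Icc (-(ρ * ‖xs i‖)) (ρ * ‖xs i‖)).indicator 1 (u i) -
      inner ℝ (ρ • e) ((τ - if u i ≤ 0 then (1 : ℝ) else 0) • xs i) ≤
      pinball τ (ys i - inner ℝ (β₀ + ρ • e) (xs i)) - pinball τ (ys i - inner ℝ β₀ (xs i)) := by
    intro i _
    have h := pinball_shift_ge (τ := τ) (u := u i) (habs i hnorm) (habs i (hN k hk))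
    have hdiff : |ρ * inner ℝ e (xs i) - ρ * inner ℝ k (xs i)| ≤ ρ * η * ‖xs i‖ := by
      rw [← mul_sub, ← inner_sub_left, abs_mul, abs_of_pos hρ, mul_assoc]
      have := (abs_real_inner_le_norm (e - k) (xs i)).trans
        (mul_le_mul_of_nonneg_right hek (norm_nonneg _))
      gcongr
    have hind : (0 : ℝ) ≤ (Icc (-(ρ * ‖xs i‖)) (ρ * ‖xs i‖)).indicator 1 (u i) :=
      indicator_nonneg (fun _ _ => zero_le_one) _
    have h2 := mul_le_mul_of_nonneg_right hdiff hind
    have e1 : ys i - inner ℝ (β₀ + ρ • e) (xs i) = u i - ρ * inner ℝ e (xs i) := by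
      rw [hu, inner_add_left, real_inner_smul_left]; ring
    rw [e1, ← hu, real_inner_smul_right, real_inner_smul_left]
    linarith
  have hsum := Finset.sum_le_sum hterm
  rw [Finset.sum_sub_distrib, Finset.sum_sub_distrib, Finset.sum_sub_distrib, ← inner_sum] at hsum
  have hlin := (real_inner_le_norm (ρ • e)
    (∑ i ∈ Finset.range n, (τ - if u i ≤ 0 then (1 : ℝ) else 0) • xs i))
  rw [norm_smul, hnorm, mul_one, Real.norm_of_nonneg hρ.le] at hlin
  have := hA k hk
  unfold qrObjective at hupper
  linarith

theorem exists_finset_dense_sphere (p : ℕ) {η : ℝ} (hη : 0 < η) :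
    ∃ N : Finset (EuclideanSpace ℝ (Fin p)), (∀ k ∈ N, ‖k‖ = 1) ∧
      ∀ e : EuclideanSpace ℝ (Fin p), ‖e‖ = 1 → ∃ k ∈ N, ‖e - k‖ ≤ η := by
  obtain ⟨t, hts, hfin, hcov⟩ :=
    finite_cover_balls_of_compact (isCompact_sphere (0 : EuclideanSpace ℝ (Fin p)) 1) hη
  refine ⟨hfin.toFinset, fun k hk => by simpa using hts (hfin.mem_toFinset.1 hk), fun e he => ?_⟩
  obtain ⟨k, hk, hek⟩ := mem_iUnion₂.1 (hcov (by simpa using he : e ∈ Metric.sphere 0 1))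
  exact ⟨k, hfin.mem_toFinset.2 hk, by simpa [dist_eq_norm] using (Metric.mem_ball.1 hek).le⟩

/-! ### Moment bounds for the linear, quadratic and discretization terms. -/

theorem integral_indicator_one_comp {Ω : Type*} [MeasurableSpace Ω] {P : Measure Ω}
    {u : Ω → ℝ} (hu : Measurable u) {s : Set ℝ}
    (hs : MeasurableSet s) : ∫ ω, s.indicator (1 : ℝ → ℝ) (u ω) ∂P = P.real {ω | u ω ∈ s} :=
  integral_indicator_one (hu hs)

section Independent

variable {Ω : Type*} [MeasurableSpace Ω] {P : Measure Ω} [IsProbabilityMeasure P]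

theorem memLp_two_comp_of_bound {u : Ω → ℝ} (hu : Measurable u) {g : ℝ → ℝ} (hg : Measurable g)
    {B : ℝ} (hB : ∀ y, |g y| ≤ B) : MemLp (fun ω => g (u ω)) 2 P :=
  MemLp.of_bound (hg.comp hu).aestronglyMeasurable B (ae_of_all _ fun ω => hB (u ω))

theorem variance_sum_comp_le {u : ℕ → Ω → ℝ} (hu : ∀ i, Measurable (u i)) (hind : iIndepFun u P)
    {g : ℕ → ℝ → ℝ} (hg : ∀ i, Measurable (g i)) {B : ℕ → ℝ} (hB : ∀ i y, |g i y| ≤ B i) (n : ℕ) :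
    variance (fun ω => ∑ i ∈ Finset.range n, g i (u i ω)) P ≤
      ∑ i ∈ Finset.range n, ∫ ω, (g i (u i ω)) ^ 2 ∂P := by
  have hL : ∀ i, MemLp (fun ω => g i (u i ω)) 2 P := fun i =>
    memLp_two_comp_of_bound (hu i) (hg i) (hB i)
  have hs : (fun ω => ∑ i ∈ Finset.range n, g i (u i ω)) =
      ∑ i ∈ Finset.range n, fun ω => g i (u i ω) := by
    ext ω; simp
  rw [hs, IndepFun.variance_sum (fun i _ => hL i)
    (fun i _ j _ hij => (hind.comp g hg).indepFun hij)]
  exact Finset.sum_le_sum fun i _ => variance_le_expectation_sq (hL i).1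

theorem measureReal_lt_le_of_integral_le {Z : Ω → ℝ} (h0 : ∀ ω, 0 ≤ Z ω) (hZ : Integrable Z P)
    {a b : ℝ} (hb : 0 < b) (ha : ∫ ω, Z ω ∂P ≤ a) : P.real {ω | b < Z ω} ≤ a / b := by
  rw [le_div_iff₀ hb, mul_comm]
  refine le_trans ?_ ((mul_meas_ge_le_integral_of_nonneg (ae_of_all _ h0) hZ b).trans ha)
  exact mul_le_mul_of_nonneg_left (measureReal_mono fun ω (h : b < Z ω) => h.le) hb.le

theorem measurable_score (τ : ℝ) : Measurable fun y : ℝ => τ - if y ≤ 0 then (1 : ℝ) else 0 :=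
  measurable_const.sub (Measurable.ite measurableSet_Iic measurable_const measurable_const)

theorem abs_score_le {τ : ℝ} (hτ : τ ∈ Ioo (0 : ℝ) 1) (y : ℝ) :
    |τ - if y ≤ 0 then (1 : ℝ) else 0| ≤ 1 := by
  rw [abs_le]
  split_ifs <;> constructor <;> linarith [hτ.1, hτ.2]

/-- Markov's inequality for the norm of the linear part of the objective. -/
theorem measureReal_lt_norm_score_sum_le {p : ℕ} {u : ℕ → Ω → ℝ} (hu : ∀ i, Measurable (u i))
    (hind : iIndepFun u P) {τ : ℝ} (hτ : τ ∈ Ioo (0 : ℝ) 1) (h0 : ∀ i, P.real {ω | u i ω ≤ 0} = τ)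
    (xs : ℕ → EuclideanSpace ℝ (Fin p)) (n : ℕ) {ρ D : ℝ} (hD : 0 < D) (hρ : 0 < ρ) :
    P.real {ω | D < ρ * ‖∑ i ∈ Finset.range n, (τ - if u i ω ≤ 0 then (1 : ℝ) else 0) • xs i‖} ≤
      (ρ ^ 2 * ∑ i ∈ Finset.range n, ‖xs i‖ ^ 2) / D ^ 2 := by
  set g : Fin p → ℕ → ℝ → ℝ := fun k i y => (τ - if y ≤ 0 then (1 : ℝ) else 0) * xs i k with hg
  have hgm : ∀ k i, Measurable (g k i) := fun k i => (measurable_score τ).mul_const _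
  have hgB : ∀ k i y, |g k i y| ≤ |xs i k| := fun k i y => by
    rw [hg, abs_mul]
    exact mul_le_of_le_one_left (abs_nonneg _) (abs_score_le hτ y)
  have hL : ∀ k i, MemLp (fun ω => g k i (u i ω)) 2 P := fun k i =>
    memLp_two_comp_of_bound (hu i) (hgm k i) (hgB k i)
  have hLs : ∀ k, MemLp (fun ω => ∑ i ∈ Finset.range n, g k i (u i ω)) 2 P := fun k =>
    memLp_finsetSum _ fun i _ => hL k i
  -- Centred because `0` is the `τ`-quantile of each residual; second moments of the sums are
  -- therefore variances.
  have hmean : ∀ k i, ∫ ω, g k i (u i ω) ∂P = 0 := by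
    intro k i
    have hI : Integrable (fun ω => (Iic (0 : ℝ)).indicator (1 : ℝ → ℝ) (u i ω)) P :=
      (memLp_two_comp_of_bound (B := 1) (hu i) (measurable_one.indicator measurableSet_Iic)
        (fun y => by by_cases h : y ≤ 0 <;> simp [h])).integrable
          one_le_two
    have h1 : ∀ ω, g k i (u i ω) =
        (τ - (Iic (0 : ℝ)).indicator (1 : ℝ → ℝ) (u i ω)) * xs i k := by
      intro ω; simp [hg, Set.indicator_apply]
    simp_rw [h1]
    rw [integral_mul_const, integral_sub (integrable_const _) hI,
      integral_indicator_one_comp (hu i) measurableSet_Iic]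
    simp [← h0 i]
  have hsq : ∀ k, ∫ ω, (∑ i ∈ Finset.range n, g k i (u i ω)) ^ 2 ∂P ≤
      ∑ i ∈ Finset.range n, (xs i k) ^ 2 := by
    intro k
    have hvar := variance_sum_comp_le hu hind (hgm k) (hgB k) n
    rw [variance_eq_sub (hLs k)] at hvar
    rw [integral_finsetSum _ fun i _ => (hL k i).integrable one_le_two,
      Finset.sum_eq_zero fun i _ => hmean k i] at hvar
    simp only [Pi.pow_apply, ne_eq, OfNat.ofNat_ne_zero, not_false_eq_true, zero_pow,
      sub_zero] at hvar
    refine hvar.trans (Finset.sum_le_sum fun i _ => ?_)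
    have : ∀ ω, (g k i (u i ω)) ^ 2 ≤ (xs i k) ^ 2 := fun ω => sq_le_sq.2 (hgB k i _)
    refine (integral_mono (hL k i).integrable_sq (integrable_const _) this).trans ?_
    simp
  have hnorm : ∀ ω, (ρ * ‖∑ i ∈ Finset.range n,
      (τ - if u i ω ≤ 0 then (1 : ℝ) else 0) • xs i‖) ^ 2 =
      ρ ^ 2 * ∑ k, (∑ i ∈ Finset.range n, g k i (u i ω)) ^ 2 := by
    intro ω
    rw [mul_pow, EuclideanSpace.norm_sq_eq]
    simp [hg]
  have hint : ∀ k, Integrable (fun ω => (∑ i ∈ Finset.range n, g k i (u i ω)) ^ 2) P := fun k =>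
    (hLs k).integrable_sq
  have hset : {ω | D < ρ * ‖∑ i ∈ Finset.range n,
      (τ - if u i ω ≤ 0 then (1 : ℝ) else 0) • xs i‖} ⊆
      {ω | D ^ 2 < ρ ^ 2 * ∑ k, (∑ i ∈ Finset.range n, g k i (u i ω)) ^ 2} := by
    intro ω hω
    rw [mem_ofPred_eq, ← hnorm]
    exact pow_lt_pow_left₀ hω hD.le two_ne_zero
  refine (measureReal_mono hset).trans (measureReal_lt_le_of_integral_le (fun ω => by positivity)
    ((integrable_finsetSum _ fun k _ => hint k).const_mul _) (by positivity) ?_)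
  rw [integral_const_mul, integral_finsetSum _ fun k _ => hint k]
  refine mul_le_mul_of_nonneg_left ((Finset.sum_le_sum fun k _ => hsq k).trans_eq ?_) (sq_nonneg _)
  rw [Finset.sum_comm]
  exact Finset.sum_congr rfl fun i _ => by rw [EuclideanSpace.norm_sq_eq]; simp

theorem measurable_shiftGain (v : ℝ) : Measurable fun u => shiftGain u v := by
  unfold shiftGain
  refine measurable_const.mul (measurable_one.indicator ?_)
  split_ifs <;> exact measurableSet_Ioc

theorem shiftGain_eq_zero_or (u v : ℝ) :
    shiftGain u v = 0 ∨ (shiftGain u v = |v| / 2 ∧ u ∈ Icc (-|v|) |v|) := by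
  unfold shiftGain
  by_cases h : u ∈ (if 0 < v then Ioc 0 (v / 2) else Ioc (v / 2) 0)
  · right
    rw [indicator_of_mem h]
    refine ⟨by simp, ?_⟩
    split_ifs at h with hv
    · rw [abs_of_pos hv]; exact ⟨by linarith [h.1], by linarith [h.2]⟩
    · rw [abs_of_nonpos (not_lt.1 hv)]; exact ⟨by linarith [h.1], by linarith [h.2]⟩
  · left
    rw [indicator_of_notMem h, mul_zero]

theorem abs_shiftGain_le (u v : ℝ) : |shiftGain u v| ≤ |v| / 2 := by
  rcases shiftGain_eq_zero_or u v with h | h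
  · rw [h, abs_zero]; positivity
  · rw [h.1, abs_of_nonneg (by positivity)]

/-- Keeping the indicator gives the second moment an extra factor of order `|v|`, which makes the
variance small compared with the squared mean. -/
theorem shiftGain_sq_le (u v : ℝ) :
    shiftGain u v ^ 2 ≤ v ^ 2 * (Icc (-|v|) |v|).indicator (1 : ℝ → ℝ) u := by
  rcases shiftGain_eq_zero_or u v with h | h
  · rw [h, zero_pow two_ne_zero]
    exact mul_nonneg (sq_nonneg _) (indicator_nonneg (fun _ _ => zero_le_one) _)
  · rw [h.1, indicator_of_mem h.2, div_pow, sq_abs, Pi.one_apply]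
    nlinarith [sq_nonneg v]

/-- Chebyshev's inequality for the quadratic part of the objective in a fixed direction. -/
theorem measureReal_sum_shiftGain_lt_le {u : ℕ → Ω → ℝ} (hu : ∀ i, Measurable (u i))
    (hind : iIndepFun u P) {c C w₀ : ℝ} (n : ℕ) (hC : 0 ≤ C)
    (hr : ∀ i, ∀ w, 0 ≤ w → w ≤ w₀ → c * w ≤ P.real {ω | u i ω ∈ Ioc 0 w})
    (hl : ∀ i, ∀ w, 0 ≤ w → w ≤ w₀ → c * w ≤ P.real {ω | u i ω ∈ Ioc (-w) 0})
    (hm : ∀ i, ∀ w, 0 ≤ w → w ≤ w₀ → P.real {ω | u i ω ∈ Icc (-w) w} ≤ 2 * C * w)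
    {v : ℕ → ℝ} {δ : ℝ} (hv : ∀ i < n, |v i| ≤ δ) (hδ : δ ≤ w₀) {A : ℝ} (hA : 0 < A) {G : ℝ}
    (hG : G + A ≤ c / 4 * ∑ i ∈ Finset.range n, v i ^ 2) :
    P.real {ω | ∑ i ∈ Finset.range n, shiftGain (u i ω) (v i) < G} ≤
      2 * C * δ * (∑ i ∈ Finset.range n, v i ^ 2) / A ^ 2 := by
  have hL : ∀ i, MemLp (fun ω => shiftGain (u i ω) (v i)) 2 P := fun i =>
    memLp_two_comp_of_bound (hu i) (measurable_shiftGain _) (fun y => abs_shiftGain_le y _)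
  have hLs : MemLp (fun ω => ∑ i ∈ Finset.range n, shiftGain (u i ω) (v i)) 2 P :=
    memLp_finsetSum _ fun i _ => hL i
  have hmean : c / 4 * ∑ i ∈ Finset.range n, v i ^ 2 ≤
      ∫ ω, ∑ i ∈ Finset.range n, shiftGain (u i ω) (v i) ∂P := by
    rw [integral_finsetSum _ fun i _ => (hL i).integrable one_le_two, Finset.mul_sum]
    refine Finset.sum_le_sum fun i hi => ?_
    have hvi := hv i (Finset.mem_range.1 hi)
    -- Multiplied by the height `|v i| / 2`, this yields the factor `c / 4` in the mean.
    have hmass : c * (|v i| / 2) ≤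
        P.real {ω | u i ω ∈ (if 0 < v i then Ioc 0 (v i / 2) else Ioc (v i / 2) 0)} := by
      have h0 := abs_nonneg (v i)
      split_ifs with h
      · have := hr i (|v i| / 2) (by positivity) (by linarith)
        rwa [abs_of_pos h] at this ⊢
      · have := hl i (|v i| / 2) (by positivity) (by linarith)
        rw [abs_of_nonpos (not_lt.1 h)] at this ⊢
        rwa [show -(-v i / 2) = v i / 2 by ring] at this
    unfold shiftGain
    rw [integral_const_mul, integral_indicator_one_comp (hu i)
      (by split_ifs <;> exact measurableSet_Ioc)]
    refine le_trans (le_of_eq ?_) (mul_le_mul_of_nonneg_left hmass (by positivity))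
    rw [← sq_abs]; ring
  have hvar : variance (fun ω => ∑ i ∈ Finset.range n, shiftGain (u i ω) (v i)) P ≤
      2 * C * δ * ∑ i ∈ Finset.range n, v i ^ 2 := by
    refine (variance_sum_comp_le hu hind (g := fun i y => shiftGain y (v i))
      (fun i => measurable_shiftGain _) (fun i y => abs_shiftGain_le y _) n).trans ?_
    rw [Finset.mul_sum]
    refine Finset.sum_le_sum fun i hi => ?_
    have hvi := hv i (Finset.mem_range.1 hi)
    have hI : Integrable (fun ω => (Icc (-|v i|) |v i|).indicator (1 : ℝ → ℝ) (u i ω)) P :=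
      (memLp_two_comp_of_bound (B := 1) (hu i) (measurable_one.indicator measurableSet_Icc)
        (fun y => by by_cases h : y ∈ Icc (-|v i|) |v i| <;> simp [Set.indicator, h])).integrable
          one_le_two
    refine (integral_mono (hL i).integrable_sq (hI.const_mul (v i ^ 2))
      fun ω => shiftGain_sq_le _ _).trans ?_
    rw [integral_const_mul, integral_indicator_one_comp (hu i) measurableSet_Icc, mul_comm]
    refine mul_le_mul_of_nonneg_right ?_ (sq_nonneg _)
    exact (hm i _ (abs_nonneg _) (hvi.trans hδ)).trans
      (mul_le_mul_of_nonneg_left hvi (by positivity))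
  have hcheb := meas_ge_le_variance_div_sq hLs hA
  have hcheb' : P.real {ω | A ≤ |∑ i ∈ Finset.range n, shiftGain (u i ω) (v i) -
      ∫ ω, ∑ i ∈ Finset.range n, shiftGain (u i ω) (v i) ∂P|} ≤
      variance (fun ω => ∑ i ∈ Finset.range n, shiftGain (u i ω) (v i)) P / A ^ 2 :=
    ENNReal.toReal_le_of_le_ofReal (div_nonneg (variance_nonneg _ _) (sq_nonneg _)) hcheb
  refine (measureReal_mono fun ω hω => ?_).trans
    (hcheb'.trans (div_le_div_of_nonneg_right hvar (sq_nonneg _)))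
  rw [mem_ofPred_eq] at hω ⊢
  rw [abs_sub_comm]
  exact le_trans (by linarith) (le_abs_self _)

/-- Markov's inequality for the discretization error. -/
theorem measureReal_lt_sum_indicator_le {u : ℕ → Ω → ℝ} (hu : ∀ i, Measurable (u i))
    {C w₀ : ℝ} (n : ℕ)
    (hm : ∀ i, ∀ w, 0 ≤ w → w ≤ w₀ → P.real {ω | u i ω ∈ Icc (-w) w} ≤ 2 * C * w)
    {V : ℕ → ℝ} (hV0 : ∀ i, 0 ≤ V i) (hV : ∀ i < n, V i ≤ w₀) {η B : ℝ} (hη : 0 ≤ η)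
    (hB : 0 < B) :
    P.real {ω | B < ∑ i ∈ Finset.range n,
      η * V i * (Icc (-V i) (V i)).indicator (1 : ℝ → ℝ) (u i ω)} ≤
      (2 * C * η * ∑ i ∈ Finset.range n, V i ^ 2) / B := by
  have hI : ∀ i, Integrable (fun ω => (Icc (-V i) (V i)).indicator (1 : ℝ → ℝ) (u i ω)) P :=
    fun i => (memLp_two_comp_of_bound (B := 1) (hu i) (measurable_one.indicator measurableSet_Icc)
      (fun y => by by_cases h : y ∈ Icc (-V i) (V i) <;> simp [Set.indicator, h])).integrable
        one_le_two
  refine measureReal_lt_le_of_integral_le (fun ω => Finset.sum_nonneg fun i _ =>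
    mul_nonneg (mul_nonneg hη (hV0 i)) (indicator_nonneg (f := (1 : ℝ → ℝ)) (fun _ _ => zero_le_one) _))
    (integrable_finsetSum _ fun i _ => (hI i).const_mul _) hB ?_
  rw [integral_finsetSum _ fun i _ => (hI i).const_mul _, Finset.mul_sum]
  refine Finset.sum_le_sum fun i hi => ?_
  rw [integral_const_mul, integral_indicator_one_comp (hu i) measurableSet_Icc]
  refine (mul_le_mul_of_nonneg_left (hm i _ (hV0 i) (hV i (Finset.mem_range.1 hi)))
    (mul_nonneg hη (hV0 i))).trans_eq ?_
  ring

end Independent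

/-! ### Consistency of quantile regression. -/

/-- Quantile regression estimates are consistent in probability, uniformly over the levels in
`[τl, τu]`. -/
theorem eventually_measureReal_norm_sub_le {p : ℕ} {X : Set (EuclideanSpace ℝ (Fin p))}
    {law : EuclideanSpace ℝ (Fin p) → Measure ℝ} [∀ x, IsProbabilityMeasure (law x)]
    {f : EuclideanSpace ℝ (Fin p) → ℝ → ℝ} {β : ℝ → EuclideanSpace ℝ (Fin p)}
    {xs : ℕ → EuclideanSpace ℝ (Fin p)} (hxs : ∀ i, xs i ∈ X)
    (h1 : LinearQuantileModel X law β) (h2 : DensityRegular X law f)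
    (h3 : DesignRegular law f xs)
    {Ω : Type*} [MeasurableSpace Ω] {P : Measure Ω} [IsProbabilityMeasure P]
    {Y : ℕ → Ω → ℝ} (hYm : ∀ i, Measurable (Y i)) (hYind : iIndepFun Y P)
    (hYlaw : ∀ i, P.map (Y i) = law (xs i))
    {βhat : ℕ → ℝ → Ω → EuclideanSpace ℝ (Fin p)} (hβ : IsQREstimator xs Y βhat)
    {τl τu : ℝ} (hl : 0 < τl) (hlu : τl < τu) (hu : τu < 1) {ε ε₀ : ℝ} (hε : 0 < ε)
    (hε₀ : 0 < ε₀) :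
    ∀ᶠ n : ℕ in atTop, ∀ τ ∈ Icc τl τu, P.real {ω | ε ≤ ‖βhat n τ ω - β τ‖} ≤ ε₀ := by
  obtain ⟨c, C, w₀, hc, hC, hw₀, hmass⟩ := exists_mass_bounds_near_quantile h1 h2 hl hlu hu
  obtain ⟨K, hK, hKn⟩ := h3.exists_sum_norm_sq_le
  obtain ⟨κ₀, hκ₀, hκn⟩ := h3.exists_le_sum_inner_sq
  -- With `A = κ M²`, the mean gain `(c / 4) κ₀ M²` equals `4A`: one `A` is given up to Chebyshev,
  -- and the remaining `3A` beats discretization error plus score, each at most `A`. The choices of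
  -- `η`, `M` and `δ` make the three failure probabilities at most `ε₀ / 3` each; `N.card + 1` also
  -- covers an empty net.
  set κ := c * κ₀ / 16 with hκ
  have hκpos : 0 < κ := by positivity
  set η := κ * ε₀ / (6 * C * K) with hη
  have hηpos : 0 < η := by positivity
  obtain ⟨N, hN, hcov⟩ := exists_finset_dense_sphere p hηpos
  set M := max 1 (3 * K / (κ ^ 2 * ε₀)) with hM
  have hM1 : 1 ≤ M := le_max_left _ _
  have hMpos : 0 < M := one_pos.trans_le hM1
  set δ := min w₀ (ε₀ * κ ^ 2 * M ^ 2 / (6 * C * K * (N.card + 1))) with hδ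
  have hδpos : 0 < δ := lt_min hw₀ (by positivity)
  have hsqrt : ∀ᶠ n : ℕ in atTop, M / ε ≤ √(n : ℝ) :=
    (Real.tendsto_sqrt_atTop.comp tendsto_natCast_atTop_atTop).eventually_ge_atTop _
  -- None of these conditions on `n` involves `τ`, whence the uniformity over levels.
  filter_upwards [hKn, (Finset.eventually_all N).2 fun k hk => hκn k (hN k hk),
    h3.eventually_norm_le (div_pos hδpos hMpos), hsqrt, eventually_gt_atTop 0]
    with n hKn hκn hmax hsq hn τ hτ
  have hτ01 : τ ∈ Ioo (0 : ℝ) 1 := ⟨hl.trans_le hτ.1, hτ.2.trans_lt hu⟩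
  have hn' : (0 : ℝ) < n := by exact_mod_cast hn
  have hsn : 0 < √(n : ℝ) := Real.sqrt_pos.2 hn'
  set ρ := M / √(n : ℝ) with hρ
  have hρpos : 0 < ρ := by positivity
  have hρε : ρ ≤ ε := by
    rw [hρ, div_le_iff₀ hsn]
    rw [div_le_iff₀ hε] at hsq
    linarith
  have hρn : ρ ^ 2 * n = M ^ 2 := by
    rw [hρ, div_pow, Real.sq_sqrt hn'.le, div_mul_cancel₀ _ hn'.ne']
  have hρK : ρ ^ 2 * ∑ i ∈ Finset.range n, ‖xs i‖ ^ 2 ≤ K * M ^ 2 := by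
    refine (mul_le_mul_of_nonneg_left hKn (sq_nonneg ρ)).trans_eq ?_
    rw [← hρn]; ring
  have hVδ : ∀ i < n, ρ * ‖xs i‖ ≤ δ := by
    intro i hi
    refine (mul_le_mul_of_nonneg_left (hmax i hi) hρpos.le).trans_eq ?_
    rw [hρ]; field_simp
  set u : ℕ → Ω → ℝ := fun i ω => Y i ω - quantile (law (xs i)) τ with hudef
  have hum : ∀ i, Measurable (u i) := fun i => (hYm i).sub_const _
  have huind : iIndepFun u P :=
    hYind.comp (fun i y => y - quantile (law (xs i)) τ) fun i => measurable_id.sub_const _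
  have hpre : ∀ i (s t : Set ℝ), MeasurableSet t →
      (∀ y, y ∈ t ↔ y - quantile (law (xs i)) τ ∈ s) →
      P.real {ω | u i ω ∈ s} = (law (xs i)).real t := by
    intro i s t ht hst
    rw [← hYlaw i, map_measureReal_apply (hYm i) ht]
    congr 1
    ext ω
    exact (hst _).symm
  have hr : ∀ i, ∀ w, 0 ≤ w → w ≤ w₀ → c * w ≤ P.real {ω | u i ω ∈ Ioc 0 w} := by
    intro i w h0 hw
    rw [hpre i _ _ measurableSet_Ioc fun y => ?_]
    · exact (hmass (xs i) (hxs i) τ hτ w h0 hw).1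
    · simp only [mem_Ioc]; constructor <;> rintro ⟨h, h'⟩ <;> constructor <;> linarith
  have hlft : ∀ i, ∀ w, 0 ≤ w → w ≤ w₀ → c * w ≤ P.real {ω | u i ω ∈ Ioc (-w) 0} := by
    intro i w h0 hw
    rw [hpre i _ _ measurableSet_Ioc fun y => ?_]
    · exact (hmass (xs i) (hxs i) τ hτ w h0 hw).2.1
    · simp only [mem_Ioc]; constructor <;> rintro ⟨h, h'⟩ <;> constructor <;> linarith
  have hm : ∀ i, ∀ w, 0 ≤ w → w ≤ w₀ → P.real {ω | u i ω ∈ Icc (-w) w} ≤ 2 * C * w := by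
    intro i w h0 hw
    rw [hpre i _ _ measurableSet_Icc fun y => ?_]
    · exact (hmass (xs i) (hxs i) τ hτ w h0 hw).2.2
    · simp only [mem_Icc]; constructor <;> rintro ⟨h, h'⟩ <;> constructor <;> linarith
  have h0 : ∀ i, P.real {ω | u i ω ≤ 0} = τ := by
    intro i
    have : NullSingletonClass (law (xs i)) := (h2.1 _ (hxs i)).nullSingletonClass
    have h := hpre i (Iic 0) (Iic (quantile (law (xs i)) τ)) measurableSet_Iic
      fun y => by simp
    rw [← cdf_eq_real, cdf_quantile _ hτ01] at h
    exact h
  set A := κ * M ^ 2 with hA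
  have hApos : 0 < A := by positivity
  set E₁ := {ω | A < ∑ i ∈ Finset.range n, η * (ρ * ‖xs i‖) *
    (Icc (-(ρ * ‖xs i‖)) (ρ * ‖xs i‖)).indicator (1 : ℝ → ℝ) (u i ω)} with hE₁
  set E₂ := {ω | A < ρ * ‖∑ i ∈ Finset.range n, (τ - if u i ω ≤ 0 then (1 : ℝ) else 0) • xs i‖}
    with hE₂
  set E₃ : EuclideanSpace ℝ (Fin p) → Set Ω := fun k =>
    {ω | ∑ i ∈ Finset.range n, shiftGain (u i ω) (ρ * inner ℝ k (xs i)) < 3 * A} with hE₃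
  have hsub : {ω | ε ≤ ‖βhat n τ ω - β τ‖} ⊆ (E₁ ∪ E₂) ∪ ⋃ k ∈ N, E₃ k := by
    intro ω hω
    by_contra hnot
    simp only [mem_union, mem_iUnion, not_or, not_exists, hE₁, hE₂, hE₃, mem_ofPred_eq,
      not_lt] at hnot
    have hlt := norm_sub_lt_of_isMinOn_qrObjective (ys := fun i => Y i ω) (β₀ := β τ)
      (u := fun i => u i ω) (fun i => by rw [← h1.1 _ (hxs i) τ hτ01]) hρpos hN hcov
      (A := 3 * A) (B := A) (D := A) (fun k hk => hnot.2 k hk)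
      (le_trans (le_of_eq (Finset.sum_congr rfl fun i _ => by ring)) hnot.1.1) hnot.1.2
      (by linarith) ((hβ n τ hτ01).2 ω)
    have hω' : ε ≤ ‖βhat n τ ω - β τ‖ := hω
    linarith
  have hP₁ : P.real E₁ ≤ ε₀ / 3 := by
    refine (measureReal_lt_sum_indicator_le hum n hm (V := fun i => ρ * ‖xs i‖)
      (fun i => by positivity) (fun i hi => (hVδ i hi).trans (min_le_left _ _)) hηpos.le
      hApos).trans ?_
    simp_rw [mul_pow]
    rw [← Finset.mul_sum, div_le_iff₀ hApos]
    refine (mul_le_mul_of_nonneg_left hρK (by positivity)).trans_eq ?_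
    rw [hη, hA]; field_simp; ring
  have hP₂ : P.real E₂ ≤ ε₀ / 3 := by
    refine (measureReal_lt_norm_score_sum_le hum huind hτ01 h0 xs n hApos hρpos).trans ?_
    rw [div_le_iff₀ (by positivity)]
    refine hρK.trans ?_
    have hM2 : 3 * K / (κ ^ 2 * ε₀) ≤ M ^ 2 :=
      (le_max_right _ _).trans (le_self_pow₀ hM1 two_ne_zero)
    rw [div_le_iff₀ (by positivity)] at hM2
    have := mul_le_mul_of_nonneg_right hM2 (sq_nonneg M)
    rw [hA]
    linarith [this, (by ring : ε₀ / 3 * (κ * M ^ 2) ^ 2 = M ^ 2 * (κ ^ 2 * ε₀) * M ^ 2 / 3)]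
  have hP₃ : ∀ k ∈ N, P.real (E₃ k) ≤ ε₀ / 3 / (N.card + 1) := by
    intro k hk
    have habs : ∀ i, |ρ * inner ℝ k (xs i)| ≤ ρ * ‖xs i‖ := by
      intro i
      rw [abs_mul, abs_of_pos hρpos]
      have := abs_real_inner_le_norm k (xs i)
      rw [hN k hk, one_mul] at this
      gcongr
    refine (measureReal_sum_shiftGain_lt_le hum huind n hC.le hr hlft hm
      (v := fun i => ρ * inner ℝ k (xs i)) (δ := δ)
      (fun i hi => (habs i).trans (hVδ i hi)) (min_le_left _ _) hApos ?_).trans ?_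
    · simp_rw [mul_pow]
      rw [← Finset.mul_sum]
      have h := mul_le_mul_of_nonneg_left (hκn k hk)
        (by positivity : 0 ≤ c / 4 * ρ ^ 2)
      have : c / 4 * ρ ^ 2 * (κ₀ * n) = 3 * A + A := by
        rw [hA, ← hρn, hκ]; ring
      linarith
    · rw [div_le_iff₀ (by positivity)]
      have hs : ∑ i ∈ Finset.range n, (ρ * inner ℝ k (xs i)) ^ 2 ≤ K * M ^ 2 := by
        refine le_trans ?_ hρK
        rw [Finset.mul_sum]
        refine Finset.sum_le_sum fun i _ => ?_
        rw [← mul_pow, ← sq_abs (ρ * inner ℝ k (xs i))]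
        exact pow_le_pow_left₀ (abs_nonneg _) (habs i) 2
      refine (mul_le_mul_of_nonneg_left hs (by positivity)).trans ?_
      have hδ2 : 2 * C * δ * (K * M ^ 2) ≤
          2 * C * (ε₀ * κ ^ 2 * M ^ 2 / (6 * C * K * (N.card + 1))) * (K * M ^ 2) := by
        have := min_le_right w₀ (ε₀ * κ ^ 2 * M ^ 2 / (6 * C * K * (N.card + 1)))
        gcongr
      refine hδ2.trans_eq ?_
      rw [hA]; field_simp; ring
  refine (measureReal_mono hsub).trans ((measureReal_union_le _ _).trans ?_)
  have h12 := measureReal_union_le (μ := P) E₁ E₂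
  have h33 : P.real (⋃ k ∈ N, E₃ k) ≤ ε₀ / 3 := by
    refine (measureReal_biUnion_finset_le N E₃).trans ((Finset.sum_le_sum hP₃).trans ?_)
    rw [Finset.sum_const, nsmul_eq_mul, mul_div_assoc', div_le_iff₀ (by positivity)]
    nlinarith
  linarith

/-! ### The generator and its error event. -/

instance : IsProbabilityMeasure unif := ⟨by simp [unif]⟩

theorem ae_unif_mem_Ioo : ∀ᵐ u ∂unif, u ∈ Ioo (0 : ℝ) 1 := ae_restrict_mem measurableSet_Ioo

/-- The grid cell `[j / m, (j + 1) / m)` of a point `u` away from the ends of `(0, 1)`. -/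
theorem grid_cell_mem {m : ℕ} {u : ℝ} (hm : 0 < m) (h1 : 1 / (m : ℝ) ≤ u)
    (h2 : u < ((m : ℝ) - 1) / m) :
    (⌊(m : ℝ) * u⌋₊ : ℝ) / m ∈ Ioo (0 : ℝ) 1 ∧ ((⌊(m : ℝ) * u⌋₊ : ℝ) + 1) / m ∈ Ioo (0 : ℝ) 1 ∧
      (⌊(m : ℝ) * u⌋₊ : ℝ) / m ≤ u ∧ u < ((⌊(m : ℝ) * u⌋₊ : ℝ) + 1) / m := by
  have hm' : (0 : ℝ) < m := by exact_mod_cast hm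
  rw [div_le_iff₀ hm', mul_comm] at h1
  rw [lt_div_iff₀ hm', mul_comm] at h2
  set j := ⌊(m : ℝ) * u⌋₊ with hj
  have hj1 : 1 ≤ j := Nat.le_floor (by simpa using h1)
  have hjle : (j : ℝ) ≤ m * u := Nat.floor_le (by linarith)
  have hjlt : (m : ℝ) * u < j + 1 := Nat.lt_floor_add_one _
  have hjm : j + 1 < m := by
    have : (j : ℝ) + 1 < m := by linarith
    exact_mod_cast this
  have hj1' : (1 : ℝ) ≤ j := by exact_mod_cast hj1
  have hjm' : (j : ℝ) + 1 < m := by exact_mod_cast hjm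
  refine ⟨⟨by positivity, ?_⟩, ⟨by positivity, ?_⟩, ?_, ?_⟩
  · rw [div_lt_one hm']; linarith
  · rwa [div_lt_one hm']
  · rw [div_le_iff₀ hm']; linarith
  · rw [lt_div_iff₀ hm']; linarith

/-- For `m ≥ 2` only levels inside `(0, 1)` are read; for `m = 1` the end levels would be `1` and
`0`. -/
theorem qrgmm_congr {m : ℕ} (hm : 2 ≤ m) {q q' : ℝ → ℝ} (h : ∀ τ ∈ Ioo (0 : ℝ) 1, q τ = q' τ)
    (u : ℝ) : qrgmm m q u = qrgmm m q' u := by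
  have hm' : (2 : ℝ) ≤ m := by exact_mod_cast hm
  have hpos : (0 : ℝ) < m := by linarith
  unfold qrgmm
  split_ifs with h1 h2
  · exact h _ ⟨by positivity, by rw [div_lt_one hpos]; linarith⟩
  · exact h _ ⟨div_pos (by linarith) hpos, by rw [div_lt_one hpos]; linarith⟩
  · obtain ⟨ha, hb, -, -⟩ := grid_cell_mem (by omega) (not_lt.1 h1) (not_le.1 h2)
    simp only [h _ ha, h _ hb]

theorem abs_qrgmm_sub_lt {m : ℕ} {u : ℝ} (hm : 0 < m) (h1 : 1 / (m : ℝ) ≤ u)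
    (h2 : u < ((m : ℝ) - 1) / m) {q : ℝ → ℝ} {a ε : ℝ}
    (hl : |q ((⌊(m : ℝ) * u⌋₊ : ℝ) / m) - a| < ε)
    (hr : |q (((⌊(m : ℝ) * u⌋₊ : ℝ) + 1) / m) - a| < ε) : |qrgmm m q u - a| < ε := by
  have hm' : (0 : ℝ) < m := by exact_mod_cast hm
  obtain ⟨-, -, hle, hlt⟩ := grid_cell_mem hm h1 h2
  unfold qrgmm
  rw [if_neg (not_lt.2 h1), if_neg (not_le.2 h2)]
  dsimp only
  set j : ℝ := (⌊(m : ℝ) * u⌋₊ : ℝ)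
  set s := m * (u - j / m) with hs
  have hs0 : 0 ≤ s := mul_nonneg hm'.le (sub_nonneg.2 hle)
  have hs1 : s < 1 := by
    rw [lt_div_iff₀ hm'] at hlt
    have : s = m * u - j := by rw [hs]; field_simp
    linarith
  rw [abs_lt] at *
  constructor <;> nlinarith

/-- The event, for data and uniform input, that the generated observation misses the quantile
function `q` by at least `ε`. -/
def genErrorSet {p : ℕ} {Ω : Type*} (βhat : ℕ → ℝ → Ω → EuclideanSpace ℝ (Fin p)) (n m : ℕ)
    (x : EuclideanSpace ℝ (Fin p)) (q : ℝ → ℝ) (ε : ℝ) : Set (Ω × ℝ) :=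
  {z | z.2 ∈ Ioo (0 : ℝ) 1 ∧ ε ≤ |genY βhat n m x z.1 z.2 - q z.2|}

/-- The level enters through the countably valued `⌊m u⌋₊`, so measurability in `ω` at each fixed
level gives joint measurability. -/
theorem measurable_genY {p : ℕ} {Ω : Type*} [MeasurableSpace Ω]
    {βhat : ℕ → ℝ → Ω → EuclideanSpace ℝ (Fin p)} {n : ℕ} (h : ∀ τ, Measurable (βhat n τ)) (m : ℕ)
    (x : EuclideanSpace ℝ (Fin p)) : Measurable fun z : Ω × ℝ => genY βhat n m x z.1 z.2 := by
  have hq : ∀ τ, Measurable fun ω => inner ℝ (βhat n τ ω) x := fun τ => (h τ).inner_const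
  have hfl : Measurable fun z : Ω × ℝ => (z.1, ⌊(m : ℝ) * z.2⌋₊) :=
    measurable_fst.prodMk (Nat.measurable_floor.comp (measurable_snd.const_mul _))
  have hq' : ∀ g : ℕ → ℝ, Measurable fun z : Ω × ℝ =>
      inner ℝ (βhat n (g ⌊(m : ℝ) * z.2⌋₊) z.1) x := fun g =>
    (measurable_from_prod_countable_left (f := fun z : Ω × ℕ => inner ℝ (βhat n (g z.2) z.1) x)
      fun k => hq (g k)).comp hfl
  have hj : Measurable fun z : Ω × ℝ => (⌊(m : ℝ) * z.2⌋₊ : ℝ) :=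
    (measurable_from_nat (f := fun k : ℕ => (k : ℝ))).comp (measurable_snd.comp hfl)
  unfold genY qrgmm
  refine Measurable.ite (measurableSet_lt measurable_snd measurable_const)
    ((hq _).comp measurable_fst) (Measurable.ite (measurableSet_le measurable_const measurable_snd)
    ((hq _).comp measurable_fst) ?_)
  have e1 := hq' fun k => (k : ℝ) / m
  have e2 := hq' fun k => ((k : ℝ) + 1) / m
  exact e1.add (((measurable_snd.sub (hj.div_const _)).const_mul _).mul (e2.sub e1))

theorem measurableSet_genErrorSet {p : ℕ} {Ω : Type*} [MeasurableSpace Ω]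
    {βhat : ℕ → ℝ → Ω → EuclideanSpace ℝ (Fin p)} {n m : ℕ}
    (h : ∀ τ ∈ Ioo (0 : ℝ) 1, Measurable (βhat n τ)) (hm : 2 ≤ m) (x : EuclideanSpace ℝ (Fin p))
    {q : ℝ → ℝ} (hq : ContinuousOn q (Ioo 0 1)) (ε : ℝ) :
    MeasurableSet (genErrorSet βhat n m x q ε) := by
  classical
  -- Estimates are known to be measurable only for levels in `(0, 1)`; they are reset to zero
  -- elsewhere, which `qrgmm_congr` shows to be harmless.
  set βt : ℕ → ℝ → Ω → EuclideanSpace ℝ (Fin p) := fun k τ ω =>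
    if τ ∈ Ioo (0 : ℝ) 1 then βhat k τ ω else 0 with hβt
  have hmeas : ∀ τ, Measurable (βt n τ) := by
    intro τ
    by_cases hτ : τ ∈ Ioo (0 : ℝ) 1
    · simpa only [hβt, if_pos hτ] using h τ hτ
    · simpa only [hβt, if_neg hτ] using measurable_const
  set qt : ℝ → ℝ := (Ioo (0 : ℝ) 1).piecewise q 0 with hqt
  have hqtm : Measurable qt :=
    hq.measurable_piecewise continuousOn_const measurableSet_Ioo
  have heq : genErrorSet βhat n m x q ε = {z : Ω × ℝ | z.2 ∈ Ioo (0 : ℝ) 1} ∩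
      {z | ε ≤ |genY βt n m x z.1 z.2 - qt z.2|} := by
    ext z
    refine and_congr_right fun hz => ?_
    have e1 : genY βhat n m x z.1 z.2 = genY βt n m x z.1 z.2 :=
      qrgmm_congr hm (fun τ hτ => by simp only [hβt, if_pos hτ]) _
    have e2 : qt z.2 = q z.2 := piecewise_eq_of_mem _ _ _ hz
    rw [e1, mem_ofPred_eq, e2]
  rw [heq]
  refine (measurable_snd measurableSet_Ioo).inter (measurableSet_le measurable_const ?_)
  exact ((measurable_genY hmeas m x).sub (hqtm.comp measurable_snd)).abs

/-- For a fixed uniform input, the generated observation converges in probability to the quantile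
function. -/
theorem tendsto_measure_genY_error {p : ℕ} {Ω : Type*} [MeasurableSpace Ω] {P : Measure Ω}
    [IsProbabilityMeasure P] {βhat : ℕ → ℝ → Ω → EuclideanSpace ℝ (Fin p)}
    {β : ℝ → EuclideanSpace ℝ (Fin p)} (hβc : ContinuousOn β (Ioo 0 1))
    (hcons : ∀ τl τu : ℝ, 0 < τl → τl < τu → τu < 1 → ∀ ε > 0, ∀ ε₀ > 0,
      ∀ᶠ n : ℕ in atTop, ∀ τ ∈ Icc τl τu, P.real {ω | ε ≤ ‖βhat n τ ω - β τ‖} ≤ ε₀)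
    (x : EuclideanSpace ℝ (Fin p)) {u : ℝ} (hu : u ∈ Ioo (0 : ℝ) 1) {ε : ℝ} (hε : 0 < ε) :
    Tendsto (fun nm : ℕ × ℕ => P {ω | ε ≤ |genY βhat nm.1 nm.2 x ω u - inner ℝ (β u) x|})
      (atTop ×ˢ atTop) (𝓝 0) := by
  have hq : ContinuousAt (fun t => inner ℝ (β t) x) u :=
    (hβc.continuousAt (Ioo_mem_nhds hu.1 hu.2)).inner continuousAt_const
  have hev : ∀ᶠ t in 𝓝 u, t ∈ Ioo (0 : ℝ) 1 ∧ |inner ℝ (β t) x - inner ℝ (β u) x| < ε / 2 :=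
    (Filter.Eventually.and (Ioo_mem_nhds hu.1 hu.2))
      (hq.eventually (Metric.ball_mem_nhds _ (half_pos hε)))
  obtain ⟨d, hd, hball⟩ := Metric.eventually_nhds_iff.1 hev
  have hd2 : ∀ t, |t - u| ≤ d / 2 → t ∈ Ioo (0 : ℝ) 1 ∧
      |inner ℝ (β t) x - inner ℝ (β u) x| < ε / 2 := fun t ht =>
    hball (by rw [Real.dist_eq]; linarith)
  have hlo := (hd2 (u - d / 2) (by
    rw [sub_sub_cancel_left, abs_neg, abs_of_pos (half_pos hd)])).1
  have hhi := (hd2 (u + d / 2) (by rw [add_sub_cancel_left, abs_of_pos (half_pos hd)])).1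
  set ε' := ε / 2 / (‖x‖ + 1) with hε'
  have hε'pos : 0 < ε' := by positivity
  have hreal : Tendsto
      (fun nm : ℕ × ℕ => P.real {ω | ε ≤ |genY βhat nm.1 nm.2 x ω u - inner ℝ (β u) x|})
      (atTop ×ˢ atTop) (𝓝 0) := by
    rw [Metric.tendsto_nhds]
    intro ε₀ hε₀
    have hm : ∀ᶠ m : ℕ in atTop, 1 / (m : ℝ) < d / 2 :=
      tendsto_one_div_atTop_nhds_zero_nat.eventually_lt_const (half_pos hd)
    filter_upwards [(hcons _ _ hlo.1 (by linarith) hhi.2 ε' hε'pos (ε₀ / 3)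
      (by positivity)).prod_mk (hm.and (eventually_gt_atTop 0))] with nm h
    obtain ⟨hn, hm, hmpos⟩ := h
    have hmpos' : (0 : ℝ) < nm.2 := by exact_mod_cast hmpos
    have h1 : 1 / (nm.2 : ℝ) ≤ u := by linarith [hlo.1]
    have h2 : u < ((nm.2 : ℝ) - 1) / nm.2 := by
      rw [sub_div, div_self hmpos'.ne']; linarith [hhi.2]
    obtain ⟨-, -, hle, hlt⟩ := grid_cell_mem hmpos h1 h2
    set a := (⌊(nm.2 : ℝ) * u⌋₊ : ℝ) / nm.2 with ha
    set b := ((⌊(nm.2 : ℝ) * u⌋₊ : ℝ) + 1) / nm.2 with hb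
    have hab : b = a + 1 / nm.2 := by rw [ha, hb]; ring
    -- Both ends of the grid cell lie within `1 / m < d / 2` of `u`.
    have hnear : ∀ t ∈ ({a, b} : Set ℝ), |t - u| ≤ d / 2 := by
      rintro t (rfl | rfl) <;> rw [abs_le] <;> constructor <;> linarith
    have hclose : ∀ t ∈ ({a, b} : Set ℝ), ∀ ω, ‖βhat nm.1 t ω - β t‖ < ε' →
        |inner ℝ (βhat nm.1 t ω) x - inner ℝ (β u) x| < ε := by
      intro t ht ω hω
      have e1 : |inner ℝ (βhat nm.1 t ω) x - inner ℝ (β t) x| ≤ ε / 2 := by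
        rw [← inner_sub_left]
        refine (abs_real_inner_le_norm _ _).trans ?_
        calc ‖βhat nm.1 t ω - β t‖ * ‖x‖ ≤ ε' * (‖x‖ + 1) := by
              gcongr; linarith
          _ = ε / 2 := by rw [hε']; field_simp
      have e2 := (hd2 t (hnear t ht)).2
      have := abs_sub_le (inner ℝ (βhat nm.1 t ω) x) (inner ℝ (β t) x) (inner ℝ (β u) x)
      linarith
    have hmemI : ∀ t ∈ ({a, b} : Set ℝ), t ∈ Icc (u - d / 2) (u + d / 2) := by
      intro t ht
      have := abs_le.1 (hnear t ht)
      constructor <;> linarith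
    have hsub : {ω | ε ≤ |genY βhat nm.1 nm.2 x ω u - inner ℝ (β u) x|} ⊆
        {ω | ε' ≤ ‖βhat nm.1 a ω - β a‖} ∪ {ω | ε' ≤ ‖βhat nm.1 b ω - β b‖} := by
      intro ω hω
      by_contra hnot
      simp only [mem_union, mem_ofPred_eq, not_or, not_le] at hnot
      exact absurd hω (not_le.2 (abs_qrgmm_sub_lt hmpos h1 h2
        (q := fun τ => inner ℝ (βhat nm.1 τ ω) x)
        (hclose a (by simp) ω hnot.1) (hclose b (by simp) ω hnot.2)))
    have hA := hn a (hmemI a (by simp))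
    have hB := hn b (hmemI b (by simp))
    have := (measureReal_mono hsub).trans (measureReal_union_le (μ := P) _ _)
    rw [Real.dist_0_eq_abs, abs_of_nonneg measureReal_nonneg]
    linarith
  have h := ENNReal.tendsto_ofReal hreal
  simpa only [ofReal_measureReal (measure_ne_top _ _), ENNReal.ofReal_zero] using h

/-- The generated observation converges in probability, jointly over data and uniform input, to
the quantile function of the uniform input. -/
theorem tendsto_prod_genErrorSet {p : ℕ} {Ω : Type*} [MeasurableSpace Ω] {P : Measure Ω}
    [IsProbabilityMeasure P] {βhat : ℕ → ℝ → Ω → EuclideanSpace ℝ (Fin p)}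
    (hmeas : ∀ n, ∀ τ ∈ Ioo (0 : ℝ) 1, Measurable (βhat n τ))
    {β : ℝ → EuclideanSpace ℝ (Fin p)} (hβc : ContinuousOn β (Ioo 0 1))
    (hcons : ∀ τl τu : ℝ, 0 < τl → τl < τu → τu < 1 → ∀ ε > 0, ∀ ε₀ > 0,
      ∀ᶠ n : ℕ in atTop, ∀ τ ∈ Icc τl τu, P.real {ω | ε ≤ ‖βhat n τ ω - β τ‖} ≤ ε₀)
    (x : EuclideanSpace ℝ (Fin p)) {ε : ℝ} (hε : 0 < ε) :
    Tendsto (fun nm : ℕ × ℕ =>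
      (P.prod unif) (genErrorSet βhat nm.1 nm.2 x (fun u => inner ℝ (β u) x) ε))
      (atTop ×ˢ atTop) (𝓝 0) := by
  have hq : ContinuousOn (fun u => inner ℝ (β u) x) (Ioo 0 1) := hβc.inner continuousOn_const
  have hev : ∀ᶠ nm : ℕ × ℕ in atTop ×ˢ atTop,
      MeasurableSet (genErrorSet βhat nm.1 nm.2 x (fun u => inner ℝ (β u) x) ε) :=
    ((eventually_ge_atTop 2).prod_inr atTop).mono fun nm hm =>
      measurableSet_genErrorSet (hmeas nm.1) hm x hq ε
  have hlim : Tendsto (fun nm : ℕ × ℕ => ∫⁻ u, P ((fun ω => (ω, u)) ⁻¹'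
      genErrorSet βhat nm.1 nm.2 x (fun u => inner ℝ (β u) x) ε) ∂unif)
      (atTop ×ˢ atTop) (𝓝 (∫⁻ _, 0 ∂unif)) := by
    -- Slicing at fixed `u` needs no uniformity as `u` approaches `0` or `1`.
    refine tendsto_lintegral_filter_of_dominated_convergence (fun _ => 1)
      (hev.mono fun nm h => measurable_measure_prodMk_right h)
      (Eventually.of_forall fun nm => ae_of_all _ fun u => prob_le_one) (by simp) ?_
    filter_upwards [ae_unif_mem_Ioo] with u hu
    refine (tendsto_measure_genY_error hβc hcons x hu hε).congr fun nm => ?_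
    congr 1
    ext ω
    exact (and_iff_right hu).symm
  rw [lintegral_zero] at hlim
  exact hlim.congr' (hev.mono fun nm h => (Measure.prod_apply_symm h).symm)

/-! ### From closeness of variables to closeness of distribution functions. -/

theorem unif_real_quantile_le (μ : Measure ℝ) [IsProbabilityMeasure μ] [NullSingletonClass μ]
    (y : ℝ) : unif.real {u | u ∈ Ioo (0 : ℝ) 1 ∧ quantile μ u ≤ y} = cdf μ y := by
  have hset : {u | u ∈ Ioo (0 : ℝ) 1 ∧ quantile μ u ≤ y} = Ioo (0 : ℝ) 1 ∩ Iic (cdf μ y) := by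
    ext u
    exact and_congr_right fun hu => quantile_le_iff μ hu
  have h0 := cdf_nonneg μ y
  have h1 := cdf_le_one μ y
  rw [hset, unif, measureReal_restrict_apply (measurableSet_Ioo.inter measurableSet_Iic),
    inter_right_comm, inter_self]
  refine le_antisymm ?_ ?_
  · refine (measureReal_mono (s₂ := Ioc 0 (cdf μ y)) (fun u hu => ⟨hu.1.1, hu.2⟩)
      (by simp)).trans_eq ?_
    rw [Real.volume_real_Ioc_of_le h0, sub_zero]
  · refine le_trans (le_of_eq ?_) (measureReal_mono (s₁ := Ioo 0 (cdf μ y))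
      (fun u hu => ⟨⟨hu.1, hu.2.trans_le h1⟩, hu.2.le⟩)
      (ne_top_of_le_ne_top (by simp) (measure_mono (inter_subset_left (s := Ioo (0 : ℝ) 1)))))
    rw [Real.volume_real_Ioo_of_le h0, sub_zero]

/-- Comparison of the distribution function of `Z` with that of `q(U)` when they are close outside
an event of small probability. -/
theorem abs_measureReal_le_sub_le {T : Type*} [MeasurableSpace T] {ν : Measure T}
    [IsProbabilityMeasure ν] {U Z : T → ℝ} (hU : ∀ᵐ t ∂ν, U t ∈ Ioo (0 : ℝ) 1) {q F : ℝ → ℝ}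
    (hF : ∀ y, ν.real {t | U t ∈ Ioo (0 : ℝ) 1 ∧ q (U t) ≤ y} = F y) (hmono : Monotone F)
    {ε : ℝ} (hε : 0 < ε) (y : ℝ) :
    |ν.real {t | Z t ≤ y} - F y| ≤
      ν.real {t | U t ∈ Ioo (0 : ℝ) 1 ∧ ε ≤ |Z t - q (U t)|} + (F (y + ε) - F (y - ε)) := by
  set B := {t | U t ∈ Ioo (0 : ℝ) 1 ∧ ε ≤ |Z t - q (U t)|} with hB
  have hU0 : ν.real {t | ¬ U t ∈ Ioo (0 : ℝ) 1} = 0 := by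
    rw [measureReal_def, ae_iff.1 hU, ENNReal.toReal_zero]
  -- Only monotonicity and subadditivity of the measure are used, so `Z` need not be measurable.
  have hup : ν.real {t | Z t ≤ y} ≤ F (y + ε) + ν.real B := by
    have hsub : {t | Z t ≤ y} ⊆ ({t | U t ∈ Ioo (0 : ℝ) 1 ∧ q (U t) ≤ y + ε} ∪ B) ∪
        {t | ¬ U t ∈ Ioo (0 : ℝ) 1} := by
      intro t (ht : Z t ≤ y)
      by_cases hUt : U t ∈ Ioo (0 : ℝ) 1
      · refine Or.inl ?_
        rcases le_or_gt ε |Z t - q (U t)| with h | h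
        · exact Or.inr ⟨hUt, h⟩
        · exact Or.inl ⟨hUt, by linarith [(abs_lt.1 h).1]⟩
      · exact Or.inr hUt
    have := (measureReal_mono hsub).trans (measureReal_union_le (μ := ν) _ _)
    have := measureReal_union_le (μ := ν) {t | U t ∈ Ioo (0 : ℝ) 1 ∧ q (U t) ≤ y + ε} B
    rw [hF] at this
    linarith
  have hlow : F (y - ε) ≤ ν.real {t | Z t ≤ y} + ν.real B := by
    rw [← hF]
    refine (measureReal_mono fun t ht => ?_).trans (measureReal_union_le (μ := ν) _ _)
    rcases le_or_gt ε |Z t - q (U t)| with h | h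
    · exact Or.inr ⟨ht.1, h⟩
    · exact Or.inl (show Z t ≤ y by linarith [(abs_lt.1 h).2, ht.2])
  have h1 := hmono (by linarith : y - ε ≤ y)
  have h2 := hmono (by linarith : y ≤ y + ε)
  rw [abs_le]
  constructor <;> linarith

theorem abs_genCDF_sub_le {p : ℕ} {Ω : Type*} [MeasurableSpace Ω] (P : Measure Ω)
    [IsProbabilityMeasure P] (βhat : ℕ → ℝ → Ω → EuclideanSpace ℝ (Fin p)) (n m : ℕ)
    (x : EuclideanSpace ℝ (Fin p)) (μ : Measure ℝ) [IsProbabilityMeasure μ]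
    [NullSingletonClass μ] {ε : ℝ} (hε : 0 < ε) (y : ℝ) :
    |genCDF P βhat n m x y - cdf μ y| ≤
      (P.prod unif).real (genErrorSet βhat n m x (quantile μ) ε) +
        (cdf μ (y + ε) - cdf μ (y - ε)) := by
  refine abs_measureReal_le_sub_le (U := Prod.snd)
    (Measure.quasiMeasurePreserving_snd.ae ae_unif_mem_Ioo) (fun y => ?_) (monotone_cdf μ) hε y
  have : {t : Ω × ℝ | t.2 ∈ Ioo (0 : ℝ) 1 ∧ quantile μ t.2 ≤ y} =
      univ ×ˢ {u | u ∈ Ioo (0 : ℝ) 1 ∧ quantile μ u ≤ y} := by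
    ext t; simp
  rw [this, measureReal_prod_prod, probReal_univ, one_mul, unif_real_quantile_le]

theorem abs_genCDFGiven_sub_le {p : ℕ} {Ω : Type*}
    (βhat : ℕ → ℝ → Ω → EuclideanSpace ℝ (Fin p)) (n m : ℕ)
    (x : EuclideanSpace ℝ (Fin p)) (ω : Ω) (μ : Measure ℝ) [IsProbabilityMeasure μ]
    [NullSingletonClass μ] {ε : ℝ} (hε : 0 < ε) (y : ℝ) :
    |genCDFGiven βhat n m x ω y - cdf μ y| ≤
      unif.real (Prod.mk ω ⁻¹' genErrorSet βhat n m x (quantile μ) ε) +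
        (cdf μ (y + ε) - cdf μ (y - ε)) :=
  abs_measureReal_le_sub_le (U := id) ae_unif_mem_Ioo (unif_real_quantile_le μ)
    (monotone_cdf μ) hε y

theorem exists_forall_cdf_sub_le (μ : Measure ℝ) [IsProbabilityMeasure μ] [NullSingletonClass μ]
    (L : ℝ) {η : ℝ} (hη : 0 < η) :
    ∃ ε : ℝ, 0 < ε ∧ ∀ y ∈ Icc 0 L, cdf μ (y + ε) - cdf μ (y - ε) ≤ η := by
  have huc := (isCompact_Icc (a := (-1 : ℝ)) (b := L + 1)).uniformContinuousOn_of_continuous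
    (continuous_cdf μ).continuousOn
  obtain ⟨d, hd, h⟩ := Metric.uniformContinuousOn_iff.1 huc η hη
  have hd3 : 0 < d / 3 := by positivity
  -- `d / 3` makes `2ε < d`; the cap `1` keeps `y ± ε` in `[-1, L + 1]`.
  refine ⟨min (d / 3) 1, lt_min hd3 one_pos, fun y hy => ?_⟩
  have e1 : min (d / 3) 1 ≤ d / 3 := min_le_left _ _
  have e2 : min (d / 3) 1 ≤ 1 := min_le_right _ _
  have e3 : 0 < min (d / 3) 1 := lt_min hd3 one_pos
  generalize min (d / 3) 1 = ε at *
  have := h (y + ε) ⟨by linarith [hy.1], by linarith [hy.2]⟩ (y - ε)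
    ⟨by linarith [hy.1], by linarith [hy.2]⟩ (by
      rw [Real.dist_eq, abs_of_nonneg (by linarith)]; linarith)
  rw [Real.dist_eq] at this
  exact (le_abs_self _).trans this.le

theorem defaultProb_eq_cdf (μ : Measure ℝ) [IsProbabilityMeasure μ] [NullSingletonClass μ]
    {r : ℝ} (hr : 0 < r) (l : ℝ) : defaultProb μ r l = cdf μ (l / r) := by
  have : {y : ℝ | 0 < max (l - r * y) 0} = Iio (l / r) := by
    ext y
    simp [lt_div_iff₀ hr, mul_comm]
  rw [defaultProb, this, cdf_eq_real, measureReal_congr (Iio_ae_eq_Iic (μ := μ))]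

/-! ### The main theorem. -/

theorem theorem1 {p : ℕ} (X : Set (EuclideanSpace ℝ (Fin p)))
    (law : EuclideanSpace ℝ (Fin p) → Measure ℝ) [∀ x, IsProbabilityMeasure (law x)]
    (f : EuclideanSpace ℝ (Fin p) → ℝ → ℝ) (β : ℝ → EuclideanSpace ℝ (Fin p))
    (xs : ℕ → EuclideanSpace ℝ (Fin p)) (hxs : ∀ i, xs i ∈ X)
    (h1 : LinearQuantileModel X law β) (h2 : DensityRegular X law f)
    (h3 : DesignRegular law f xs)
    {Ω : Type*} [MeasurableSpace Ω] (P : Measure Ω) [IsProbabilityMeasure P]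
    (Y : ℕ → Ω → ℝ) (hYm : ∀ i, Measurable (Y i)) (hYind : iIndepFun Y P)
    (hYlaw : ∀ i, P.map (Y i) = law (xs i))
    (βhat : ℕ → ℝ → Ω → EuclideanSpace ℝ (Fin p)) (hβ : IsQREstimator xs Y βhat)
    (r lbar : ℝ) (hr : 0 < r) (hl : 0 ≤ lbar)
    (x : EuclideanSpace ℝ (Fin p)) (hx : x ∈ X) :
    (∀ l ∈ Icc 0 lbar, defaultProb (law x) r l = cdf (law x) (l / r)) ∧
    (∀ l ∈ Icc 0 lbar,
      Tendsto (fun nm : ℕ × ℕ => genCDF P βhat nm.1 nm.2 x (l / r)) (atTop ×ˢ atTop)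
        (𝓝 (defaultProb (law x) r l))) ∧
    Tendsto (fun nm : ℕ × ℕ => ⨆ l : Icc 0 lbar,
        |genCDF P βhat nm.1 nm.2 x (l / r) - defaultProb (law x) r l|)
      (atTop ×ˢ atTop) (𝓝 0) ∧
    (∀ l ∈ Icc 0 lbar,
      TendstoInMeasure P (fun (nm : ℕ × ℕ) ω => genCDFGiven βhat nm.1 nm.2 x ω (l / r))
        (atTop ×ˢ atTop) (fun _ => defaultProb (law x) r l)) ∧
    TendstoInMeasure P (fun (nm : ℕ × ℕ) ω => ⨆ l : Icc 0 lbar,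
        |genCDFGiven βhat nm.1 nm.2 x ω (l / r) - defaultProb (law x) r l|)
      (atTop ×ˢ atTop) (fun _ => 0) := by
  have hd := h2.1 x hx
  have : NullSingletonClass (law x) := hd.nullSingletonClass
  have hcons : ∀ τl τu : ℝ, 0 < τl → τl < τu → τu < 1 → ∀ ε > 0, ∀ ε₀ > 0,
      ∀ᶠ n : ℕ in atTop, ∀ τ ∈ Icc τl τu, P.real {ω | ε ≤ ‖βhat n τ ω - β τ‖} ≤ ε₀ :=
    fun _ _ a b c _ hε _ hε₀ =>
      eventually_measureReal_norm_sub_le hxs h1 h2 h3 hYm hYind hYlaw hβ a b c hε hε₀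
  have hmeas : ∀ n, ∀ τ ∈ Ioo (0 : ℝ) 1, Measurable (βhat n τ) := fun n τ hτ => (hβ n τ hτ).1
  have hset : ∀ n m ε, genErrorSet βhat n m x (quantile (law x)) ε =
      genErrorSet βhat n m x (fun u => inner ℝ (β u) x) ε := by
    intro n m ε
    ext z
    exact and_congr_right fun hz => by rw [h1.1 x hx z.2 hz]
  have hq : ContinuousOn (fun u => inner ℝ (β u) x) (Ioo 0 1) := h1.2.inner continuousOn_const
  have herr : ∀ ε > 0, Tendsto (fun nm : ℕ × ℕ =>
      (P.prod unif) (genErrorSet βhat nm.1 nm.2 x (quantile (law x)) ε))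
      (atTop ×ˢ atTop) (𝓝 0) := by
    intro ε hε
    simp only [hset]
    exact tendsto_prod_genErrorSet hmeas h1.2 hcons x hε
  have hdef : ∀ l, defaultProb (law x) r l = cdf (law x) (l / r) :=
    fun l => defaultProb_eq_cdf _ hr l
  have hlr : ∀ l ∈ Icc 0 lbar, l / r ∈ Icc 0 (lbar / r) := fun l hl =>
    ⟨div_nonneg hl.1 hr.le, div_le_div_of_nonneg_right hl.2 hr.le⟩
  have hsup : Tendsto (fun nm : ℕ × ℕ => ⨆ l : Icc 0 lbar,
      |genCDF P βhat nm.1 nm.2 x (l / r) - defaultProb (law x) r l|)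
      (atTop ×ˢ atTop) (𝓝 0) := by
    rw [Metric.tendsto_nhds]
    intro η hη
    obtain ⟨ε, hε, hmod⟩ := exists_forall_cdf_sub_le (law x) (lbar / r) (by positivity : 0 < η / 3)
    have h := (ENNReal.tendsto_toReal ENNReal.zero_ne_top).comp (herr ε hε)
    have hη3 : ENNReal.toReal 0 < η / 3 := by
      rw [ENNReal.toReal_zero]; positivity
    filter_upwards [h.eventually_lt_const hη3] with nm hnm
    rw [Real.dist_0_eq_abs, abs_of_nonneg (Real.iSup_nonneg fun _ => abs_nonneg _)]
    refine lt_of_le_of_lt (Real.iSup_le (fun l => ?_) (by positivity : 0 ≤ η / 3 + η / 3))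
      (by linarith)
    rw [hdef]
    exact (abs_genCDF_sub_le P βhat nm.1 nm.2 x (law x) hε _).trans
      (add_le_add hnm.le (hmod _ (hlr l l.2)))
  -- A real `⨆` over an unbounded family is `0` by convention, so boundedness is needed to pass from
  -- the supremum to a single loan.
  have hbdd : ∀ g : Icc 0 lbar → ℝ, (∀ l, g l ∈ Icc (0 : ℝ) 1) →
      BddAbove (range fun l : Icc 0 lbar => |g l - defaultProb (law x) r l|) := by
    refine fun g hg => ⟨1, ?_⟩
    rintro _ ⟨l, rfl⟩
    dsimp only
    rw [hdef, abs_le]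
    have h0 := cdf_nonneg (law x) (l / r)
    have h1 := cdf_le_one (law x) (l / r)
    constructor <;> linarith [(hg l).1, (hg l).2]
  have hsupGiven : TendstoInMeasure P (fun (nm : ℕ × ℕ) ω => ⨆ l : Icc 0 lbar,
      |genCDFGiven βhat nm.1 nm.2 x ω (l / r) - defaultProb (law x) r l|)
      (atTop ×ˢ atTop) (fun _ => 0) := by
    rw [tendstoInMeasure_iff_dist]
    intro η hη
    have hη3 : 0 < η / 3 := by positivity
    obtain ⟨ε, hε, hmod⟩ := exists_forall_cdf_sub_le (law x) (lbar / r) hη3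
    have hη3' : ENNReal.ofReal (η / 3) ≠ 0 := by simpa using hη3
    have hlim := ENNReal.Tendsto.div_const (b := ENNReal.ofReal (η / 3)) (herr ε hε) (Or.inr hη3')
    rw [ENNReal.zero_div] at hlim
    refine tendsto_of_tendsto_of_tendsto_of_le_of_le' tendsto_const_nhds hlim
      (Eventually.of_forall fun _ => zero_le) ?_
    filter_upwards [(eventually_ge_atTop 2).prod_inr atTop] with nm hm
    have hms : MeasurableSet (genErrorSet βhat nm.1 nm.2 x (quantile (law x)) ε) := by
      rw [hset]
      exact measurableSet_genErrorSet (hmeas nm.1) hm x hq ε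
    rw [Measure.prod_apply hms]
    -- Markov's inequality for the conditional error probability: it must be at least `η / 3`
    -- wherever the supremum reaches `η`, since the CDF increment contributes at most `η / 3`.
    refine (measure_mono fun ω hω => ?_).trans (meas_ge_le_lintegral_div
      (measurable_measure_prodMk_left hms).aemeasurable hη3' ENNReal.ofReal_ne_top)
    change ENNReal.ofReal (η / 3) ≤ unif _
    rw [ENNReal.ofReal_le_iff_le_toReal (measure_ne_top _ _)]
    by_contra! hlt
    have hω' : η ≤ dist (⨆ l : Icc 0 lbar,
      |genCDFGiven βhat nm.1 nm.2 x ω (l / r) - defaultProb (law x) r l|) 0 := hω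
    rw [Real.dist_0_eq_abs, abs_of_nonneg (Real.iSup_nonneg fun _ => abs_nonneg _)] at hω'
    have : (⨆ l : Icc 0 lbar,
        |genCDFGiven βhat nm.1 nm.2 x ω (l / r) - defaultProb (law x) r l|) ≤ η / 3 + η / 3 := by
      refine Real.iSup_le (fun l => ?_) (by positivity)
      rw [hdef]
      exact (abs_genCDFGiven_sub_le βhat nm.1 nm.2 x ω (law x) hε _).trans
        (add_le_add hlt.le (hmod _ (hlr l l.2)))
    linarith
  refine ⟨fun l _ => hdef l, fun l hl' => ?_, hsup, fun l hl' => ?_, hsupGiven⟩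
  · rw [tendsto_iff_dist_tendsto_zero]
    refine squeeze_zero (fun _ => dist_nonneg) (fun nm => ?_) hsup
    exact le_ciSup (hbdd (fun l => genCDF P βhat nm.1 nm.2 x (l / r))
      fun l => ⟨measureReal_nonneg, measureReal_le_one⟩) ⟨l, hl'⟩
  · rw [tendstoInMeasure_iff_dist] at hsupGiven ⊢
    intro η hη
    refine tendsto_of_tendsto_of_tendsto_of_le_of_le tendsto_const_nhds (hsupGiven η hη)
      (fun _ => zero_le) fun nm => measure_mono fun ω hω => ?_
    refine le_trans (show η ≤ dist _ _ from hω) (le_trans ?_ (le_abs_self _))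
    rw [sub_zero]
    exact le_ciSup (hbdd (fun l => genCDFGiven βhat nm.1 nm.2 x ω (l / r))
      fun l => ⟨measureReal_nonneg, measureReal_le_one⟩) ⟨l, hl'⟩
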